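/- Let $f$ be a modular function for $\Gamma=\mathrm{PSL}(2,\mathbb Z)$, that is, a $\Gamma$-invariant holomorphic function on the upper half plane $\mathcal H$ that is meromorphic at the cusp. For a real quadratic irrationality $w$, let $Q_w=[a,b,c]$ be the primitive integral binary quadratic form of discriminant $D=b^2-4ac>0$ with $w=\frac{-b+\sqrt D}{2a}$, let $(t,u)$ be the smallest positive integer solution of $t^2-Du^2=4$, and put $\varepsilon=\frac{t+u\sqrt D}{2}$. Let $A_w=\begin{pmatrix}\frac{t-bu}{2}&-cu\\ au&\frac{t+bu}{2}\end{pmatrix}$, the generator of the stabilizer $\Gamma_w$ of $w$ in $\Gamma$, let $S_w$ be the geodesic $a|z|^2+b\,\mathrm{Re}(z)+c=0$ in $\mathcal H$, and let $C_w=S_w/\Gamma_w$, oriented from $z_0$ to $A_w^{-1}z_0$ $(z_0\in S_w)$. Put $$f(w)=\int_{C_w}\frac{\sqrt D\,f(z)}{Q_w(z,1)}\,dz,\qquad f^{nor}(w)=\frac{f(w)}{2\log\varepsilon}.$$ The Markov tree is the infinite binary tree of quadratic irrationalities with purely periodic regular continued fractions defined as follows. For $x=[\overline{s_0,\dots,s_k}]$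 and $y=[\overline{t_0,\dots,t_m}]$ with the given periods let $x\odot y=[\overline{s_0,\dots,s_k,t_0,\dots,t_m}]$. Every vertex $v$ has a left predecessor $\ell$ and a right predecessor $r$, and $v=r\odot\ell$. The root $[\overline{2,2,1,1}]$ has left predecessor $[\overline{1,1}]$ and right predecessor $[\overline{2,2}]$; the left child of $v$ is $v\odot\ell$, with left and right predecessors $\ell$ and $v$; the right child of $v$ is $r\odot v$, with left and right predecessors $v$ and $r$. A left (right) branch $B$ is a maximal downward path all of whose steps go to the left (right); its first vertex, the tip, is thus the root, or a right (left) child. Let $w_1^B,w_2^B,\dots$ be the successive vertices of $B$, starting with the tip, and let $w_0^B$ be the left (right) predecessor of the tip if $B$ is a left (right) branch. Theorem. For every modular function $f$ and every branch $B$ of the Markov tree there is a constant $N_{f,B}$ such that, for all $n\ge N_{f,B}$, the real part of $f^{nor}(w^B_{n+1})$ lies between the real parts of $f^{nor}(w^B_0)$ and $f^{nor}(w^B_n)$, and the imaginary part of $f^{nor}(w^B_{n+1})$ lies between the imaginary parts of $f^{nor}(w^B_0)$ and $f^{nor}(w^B_n)$. Here "lies between" means strictly between, unless the three numbers are all equal.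 -/

import Mathlib

open scoped UpperHalfPlane Manifold MatrixGroups

noncomputable section

namespace MarkovCycle

/-! ### Modular functions -/

/-- A modular function for `PSL(2, ℤ)`: holomorphic on the upper half plane, invariant under the
modular group, and meromorphic at the cusp, as a function of `q = exp (2 π i z)`. -/
structure IsModularFunction (f : ℍ → ℂ) : Prop where
  holo : MDifferentiable 𝓘(ℂ) 𝓘(ℂ) f
  invariant : ∀ (γ : SL(2, ℤ)) (z : ℍ), f (γ • z) = f z
  meromorphic_cusp : MeromorphicAt (UpperHalfPlane.cuspFunction 1 f) 0

/-! ### Cycle integrals -/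

/-- An integral binary quadratic form `[a, b, c]`, that is `a X² + b X Y + c Y²`. -/
structure IntForm where
  a : ℤ
  b : ℤ
  c : ℤ

instance : Inhabited IntForm := ⟨⟨0, 0, 0⟩⟩

namespace IntForm

/-- The discriminant `b² - 4ac`. -/
def disc (Q : IntForm) : ℤ := Q.b ^ 2 - 4 * Q.a * Q.c

/-- `Q` is primitive, of positive discriminant `D`, and `w = (-b + √D) / (2a)`. The choice of the
square root fixes the sign of `Q`, so that an irrational `w` has at most one such `Q`. -/
def HasRoot (Q : IntForm) (w : ℝ) : Prop :=
  Q.a ≠ 0 ∧ Int.gcd (Int.gcd Q.a Q.b) Q.c = 1 ∧ 0 < Q.disc ∧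
    w = (-(Q.b : ℝ) + √(Q.disc : ℝ)) / (2 * (Q.a : ℝ))

/-- The value `Q(z, 1)`. -/
def eval (Q : IntForm) (z : ℂ) : ℂ := (Q.a : ℂ) * z ^ 2 + (Q.b : ℂ) * z + (Q.c : ℂ)

/-- The component `u` of the smallest positive solution `(t, u)` of `t² - D u² = 4`. -/
def pellU (Q : IntForm) : ℕ :=
  sInf {u : ℕ | 0 < u ∧ ∃ t : ℕ, (t : ℤ) ^ 2 - Q.disc * (u : ℤ) ^ 2 = 4}

/-- The component `t` of the smallest positive solution `(t, u)` of `t² - D u² = 4`. -/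
def pellT (Q : IntForm) : ℕ :=
  sInf {t : ℕ | 0 < t ∧ (t : ℤ) ^ 2 - Q.disc * (Q.pellU : ℤ) ^ 2 = 4}

/-- The unit `ε = (t + u √D) / 2`. -/
def unit (Q : IntForm) : ℝ := ((Q.pellT : ℝ) + (Q.pellU : ℝ) * √(Q.disc : ℝ)) / 2

/-- The generator `A_w` of the stabilizer of the root `w` of `Q` in the modular group. -/
def stab (Q : IntForm) : Matrix (Fin 2) (Fin 2) ℝ :=
  !![((Q.pellT : ℝ) - Q.b * Q.pellU) / 2, -(Q.c : ℝ) * Q.pellU;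
     (Q.a : ℝ) * Q.pellU, ((Q.pellT : ℝ) + Q.b * Q.pellU) / 2]

/-- The center of the semicircle `a |z|² + b Re z + c = 0`. -/
def center (Q : IntForm) : ℝ := -(Q.b : ℝ) / (2 * (Q.a : ℝ))

/-- The radius of the semicircle `a |z|² + b Re z + c = 0`. -/
def radius (Q : IntForm) : ℝ := √(Q.disc : ℝ) / (2 * |(Q.a : ℝ)|)

/-- The point of the geodesic `a |z|² + b Re z + c = 0` at angle `θ`, for `0 < θ < π`. -/
def point (Q : IntForm) (θ : ℝ) : ℂ :=
  (Q.center : ℂ) + (Q.radius : ℂ) * Complex.exp ((θ : ℂ) * Complex.I)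

end IntForm

/-- The Möbius action of a real `2 × 2` matrix on complex numbers. -/
def moebius (M : Matrix (Fin 2) (Fin 2) ℝ) (z : ℂ) : ℂ :=
  ((M 0 0 : ℂ) * z + (M 0 1 : ℂ)) / ((M 1 0 : ℂ) * z + (M 1 1 : ℂ))

namespace IntForm

/-- The angle of the point `A_w⁻¹ z₀` of the geodesic, where `z₀` is the top of the semicircle,
that is the point at angle `π / 2`. -/
def endAngle (Q : IntForm) : ℝ :=
  Complex.arg (moebius (Q.stab)⁻¹ (Q.point (Real.pi / 2)) - (Q.center : ℂ))

/-- The contour integral of `√D f(z) / Q(z, 1) dz` over the geodesic `S_w` modulo the stabilizer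
of `w`: along the arc of `S_w` from the top `z₀` to `A_w⁻¹ z₀`, parametrized by the angle. -/
def cycleIntegral (Q : IntForm) (f : ℍ → ℂ) : ℂ :=
  ∫ θ in (Real.pi / 2)..Q.endAngle,
    ((√(Q.disc : ℝ) : ℝ) : ℂ) * f (UpperHalfPlane.ofComplex (Q.point θ)) / Q.eval (Q.point θ) *
      deriv Q.point θ

end IntForm

/-- The primitive form `Q_w` of a real quadratic irrationality `w`. -/
def formOf (w : ℝ) : IntForm := Classical.epsilon fun Q : IntForm => Q.HasRoot w

/-- The value `f(w)` of a modular function at a real quadratic irrationality. -/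
def val (f : ℍ → ℂ) (w : ℝ) : ℂ := (formOf w).cycleIntegral f

/-- The normalized value `f(w) / (2 log ε)`. -/
def valNor (f : ℍ → ℂ) (w : ℝ) : ℂ :=
  val f w / ((2 * Real.log (formOf w).unit : ℝ) : ℂ)

/-! ### The Markov tree -/

/-- The regular continued fraction `[a₀, a₁, a₂, …]`. -/
def regularCF (a : ℕ → ℕ) : GenContFract ℝ :=
  ⟨(a 0 : ℝ), Stream'.Seq.ofStream fun n => ⟨1, (a (n + 1) : ℝ)⟩⟩

/-- The real number given by the purely periodic regular continued fraction with period `s`,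
the limit of its convergents (for `s` a nonempty list of positive integers). -/
def periodicCF (s : List ℕ) : ℝ :=
  Filter.limUnder Filter.atTop (regularCF fun n => s.getD (n % s.length) 0).convs

/-- The two directions in the Markov tree, going downwards. -/
inductive Side
  | left
  | right

/-- The periods of the left and of the right predecessor of the vertex that is reached from the
root `[2, 2, 1, 1]` of the tree by the path `p`. A vertex is the conjunction
(right predecessor) ⊙ (left predecessor), where `⊙` concatenates the periods; going down to the
left, it becomes the right predecessor of the new vertex, and going down to the right, the left
predecessor. -/
def predecessors (p : List Side) : List ℕ × List ℕ :=
  p.foldl (fun x d => match d with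
    | Side.left => (x.1, x.2 ++ x.1)
    | Side.right => (x.2 ++ x.1, x.2)) ([1, 1], [2, 2])

/-- The period of the vertex of the Markov tree reached from the root by the path `p`. -/
def vertex (p : List Side) : List ℕ := (predecessors p).2 ++ (predecessors p).1

/-- A branch of the Markov tree: a maximal downward path without zigzags. It is given by its tip
(the path from the root to the tip) and its side; the step that leads to the tip, if there is
one, goes to the other side. -/
structure Branch where
  side : Side
  tip : List Side
  isTip : tip.getLast? ≠ some side

namespace Branch

/-- The period of the `n`-th quadratic on the branch: the vertices of the branch for `n ≥ 1`, and
for `n = 0` the left (right) predecessor of the tip, if the branch is a left (right) branch. -/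
def period (B : Branch) : ℕ → List ℕ
  | 0 => match B.side with
    | Side.left => (predecessors B.tip).1
    | Side.right => (predecessors B.tip).2
  | n + 1 => vertex (B.tip ++ List.replicate n B.side)

/-- The Markov quadratic `w_n` on the branch. -/
def quad (B : Branch) (n : ℕ) : ℝ := periodicCF (B.period n)

end Branch

/-- `x` lies between `y` and `z`: strictly, unless the three numbers coincide. -/
def LiesBetween (x y z : ℝ) : Prop := x ∈ Set.uIoo y z ∨ (x = y ∧ x = z)

end MarkovCycle

end

namespace MarkovCycle

/-! By partial fractions `√D / Q_w(z, 1) dz` is the form `(1/(z - α) - 1/(z - β)) dz`, where `α = w`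
and `β` is its conjugate. Modular transformations carry such forms to one another together with
their end points, so `f(w)` is the integral of `f` against this form from `A_w z` to `z`, for any
`z`. After division by the translation length `2 log ε` the result is a mean along the geodesic, and
`A_w` may be replaced by another hyperbolic element fixing `α` and `β` (`valNor_eq`), in particular
by the product matrix `γ` of the period. Thus `f^nor` is a quotient of two integrals from `γ i` to
`i`, one for `f` and one for the constant `1` (`Represents.valNor_eq`).

Along a branch the periods are `V Uⁿ` or `Uⁿ V`, and conjugation reduces both to the matrices `Uⁿ
V`. Let `e > 1` be the larger eigenvalue of `U`, and `q = e⁻²`. In coordinates diagonalizing `U`,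
the fixed points of `Uⁿ V` depend analytically on `x = qⁿ` (`exists_analytic_roots`). Cut the path
from `Uⁿ V i` to `i` at the points `Uᵏ i` and move each piece back by `Uᵏ`: its integral becomes a
difference of analytic functions at `qⁿ⁻ᵏ ρ(x)` and `qᵏ τ(x)`. Such a geometric sum is `n` times the
value at `0` plus boundary terms analytic in `x` (`exists_analytic_q_sum`). Hence each integral is
`n` times that of `U` plus `B(qⁿ)`, with `B` analytic at `0` (`exists_expansion`).

Taking the quotient, `f^nor(w_n) - f^nor(w_0) = K(qⁿ) / (n E + d(qⁿ))` with `E > 0`, `d` real and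
`K`, `d` analytic. The real part of `K` either vanishes near `0` or behaves like `c xᵐ` with `c ≠
0`. In the second case the real part of the error eventually has constant sign and strictly
decreasing absolute value, because of the growing denominator even when `m = 0`
(`eventually_liesBetween`). The same holds for the imaginary part. -/

open Complex Filter Topology

/-! ### Modular transformations of the upper half plane -/

/-- The Möbius action of an integral matrix of determinant one on complex numbers. -/
noncomputable def mob (γ : SL(2, ℤ)) (z : ℂ) : ℂ :=
  ((γ 0 0 : ℂ) * z + (γ 0 1 : ℂ)) / ((γ 1 0 : ℂ) * z + (γ 1 1 : ℂ))

lemma det_eq_one (γ : SL(2, ℤ)) : γ 0 0 * γ 1 1 - γ 0 1 * γ 1 0 = 1 := by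
  have := γ.det_coe
  rwa [Matrix.det_fin_two] at this

lemma det_eq_one_complex (γ : SL(2, ℤ)) :
    (γ 0 0 : ℂ) * γ 1 1 - (γ 0 1 : ℂ) * γ 1 0 = 1 := by
  exact_mod_cast congrArg (Int.cast : ℤ → ℂ) (det_eq_one γ)

lemma det_eq_one_real (γ : SL(2, ℤ)) :
    (γ 0 0 : ℝ) * γ 1 1 - (γ 0 1 : ℝ) * γ 1 0 = 1 := by
  exact_mod_cast congrArg (Int.cast : ℤ → ℝ) (det_eq_one γ)

lemma mob_coe (γ : SL(2, ℤ)) (z : ℍ) : mob γ z = ((γ • z : ℍ) : ℂ) := by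
  rw [UpperHalfPlane.coe_specialLinearGroup_apply]
  simp [mob]

lemma mob_im_pos (γ : SL(2, ℤ)) {z : ℂ} (hz : 0 < z.im) : 0 < (mob γ z).im := by
  have := mob_coe γ ⟨z, hz⟩
  simp only at this
  rw [this]
  exact (γ • (⟨z, hz⟩ : ℍ)).im_pos

lemma mob_mul (γ δ : SL(2, ℤ)) {z : ℂ} (hz : 0 < z.im) :
    mob (γ * δ) z = mob γ (mob δ z) := by
  have h1 := mob_coe δ ⟨z, hz⟩
  have h2 := mob_coe (γ * δ) ⟨z, hz⟩
  have h3 := mob_coe γ (δ • ⟨z, hz⟩)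
  simp only at h1 h2
  rw [h1, h2, h3, mul_smul]

lemma denom_ne_zero (γ : SL(2, ℤ)) {z : ℂ} (hz : 0 < z.im) :
    (γ 1 0 : ℂ) * z + (γ 1 1 : ℂ) ≠ 0 := by
  intro h
  have him := congrArg Complex.im h
  simp only [add_im, mul_im, intCast_re, intCast_im, zero_mul, add_zero, zero_im] at him
  have h10 : (γ 1 0 : ℝ) = 0 := by
    rcases mul_eq_zero.mp him with h | h
    · exact h
    · exact absurd h hz.ne'
  have h10' : (γ 1 0 : ℂ) = 0 := by exact_mod_cast h10
  have h11 : (γ 1 1 : ℂ) = 0 := by simpa [h10'] using h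
  have := det_eq_one_complex γ
  simp [h10', h11] at this

lemma sub_real_ne_zero {z : ℂ} (hz : 0 < z.im) (a : ℝ) : z - (a : ℂ) ≠ 0 := by
  intro h
  have := congrArg Complex.im h
  simp at this
  exact hz.ne' this

lemma hasDerivAt_mob (γ : SL(2, ℤ)) {z : ℂ} (hz : 0 < z.im) :
    HasDerivAt (mob γ) (1 / ((γ 1 0 : ℂ) * z + (γ 1 1 : ℂ)) ^ 2) z := by
  have hd := denom_ne_zero γ hz
  have h1 : HasDerivAt (fun z : ℂ => (γ 0 0 : ℂ) * z + (γ 0 1 : ℂ)) (γ 0 0 : ℂ) z := by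
    simpa using ((hasDerivAt_id z).const_mul (γ 0 0 : ℂ)).add_const (γ 0 1 : ℂ)
  have h2 : HasDerivAt (fun z : ℂ => (γ 1 0 : ℂ) * z + (γ 1 1 : ℂ)) (γ 1 0 : ℂ) z := by
    simpa using ((hasDerivAt_id z).const_mul (γ 1 0 : ℂ)).add_const (γ 1 1 : ℂ)
  refine (h1.fun_div h2 hd).congr_deriv ?_
  rw [div_left_inj' (pow_ne_zero 2 hd)]
  linear_combination det_eq_one_complex γ

/-! ### Primitives and line integrals of invariant functions -/

/-- A holomorphic function on the upper half plane (extended by junk values to `ℂ`) that is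
invariant under the modular group. -/
structure IsInvariantHolomorphic (g : ℂ → ℂ) : Prop where
  diff : DifferentiableOn ℂ g {z | 0 < z.im}
  inv : ∀ (γ : SL(2, ℤ)) (z : ℂ), 0 < z.im → g (mob γ z) = g z

lemma IsModularFunction.isInvariantHolomorphic {f : ℍ → ℂ} (hf : IsModularFunction f) :
    IsInvariantHolomorphic fun z => f (UpperHalfPlane.ofComplex z) where
  diff := UpperHalfPlane.mdifferentiable_iff.mp hf.holo
  inv γ z hz := by
    have h := mob_coe γ ⟨z, hz⟩
    simp only at h
    rw [h, UpperHalfPlane.ofComplex_apply, UpperHalfPlane.ofComplex_apply_of_im_pos hz,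
      hf.invariant]

lemma isInvariantHolomorphic_one : IsInvariantHolomorphic fun _ => 1 where
  diff := differentiableOn_const _
  inv _ _ _ := rfl

lemma isOpen_im_pos : IsOpen {z : ℂ | 0 < z.im} := isOpen_lt continuous_const continuous_im

lemma convex_im_pos : Convex ℝ {z : ℂ | 0 < z.im} := convex_halfSpace_im_gt 0

/-- `F` is a primitive on the upper half plane of `g(z) (1 / (z - α) - 1 / (z - β)) dz`. -/
def IsPrimitive (g : ℂ → ℂ) (α β : ℝ) (F : ℂ → ℂ) : Prop :=
  ∀ z : ℂ, 0 < z.im → HasDerivAt F (g z * ((z - α)⁻¹ - (z - β)⁻¹)) z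

variable {g : ℂ → ℂ}

lemma IsInvariantHolomorphic.exists_isPrimitive (hg : IsInvariantHolomorphic g) (α β : ℝ) :
    ∃ F, IsPrimitive g α β F := by
  have hd : DifferentiableOn ℂ (fun z : ℂ => g z * ((z - α)⁻¹ - (z - β)⁻¹)) {z | 0 < z.im} := by
    refine hg.diff.mul (DifferentiableOn.sub ?_ ?_)
    · exact DifferentiableOn.inv (by fun_prop) fun z hz => sub_real_ne_zero hz α
    · exact DifferentiableOn.inv (by fun_prop) fun z hz => sub_real_ne_zero hz β
  obtain ⟨F, hF⟩ := convex_im_pos.exists_forall_hasDerivWithinAt hd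
  exact ⟨F, fun z hz => (hF z hz).hasDerivAt (isOpen_im_pos.mem_nhds hz)⟩

lemma IsPrimitive.sub_eq_sub {α β : ℝ} {F₁ F₂ : ℂ → ℂ} (h₁ : IsPrimitive g α β F₁)
    (h₂ : IsPrimitive g α β F₂) {z w : ℂ} (hz : 0 < z.im) (hw : 0 < w.im) :
    F₁ z - F₁ w = F₂ z - F₂ w := by
  have hd : ∀ x : ℂ, 0 < x.im → HasDerivAt (fun x => F₁ x - F₂ x) 0 x := fun x hx =>
    ((h₁ x hx).fun_sub (h₂ x hx)).congr_deriv (sub_self _)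
  have := isOpen_im_pos.is_const_of_deriv_eq_zero convex_im_pos.isPreconnected
    (fun x hx => (hd x hx).differentiableAt.differentiableWithinAt)
    (fun x hx => (hd x hx).deriv) hz hw
  linear_combination this

/-- The real Möbius action maps the finite point `α` to the finite point `α'`. -/
def MapsReal (γ : SL(2, ℤ)) (α α' : ℝ) : Prop :=
  (γ 1 0 : ℝ) * α + γ 1 1 ≠ 0 ∧ α' * ((γ 1 0 : ℝ) * α + γ 1 1) = (γ 0 0 : ℝ) * α + γ 0 1

/-- The correction term does not depend on `α`, so it cancels in the difference of two poles; this
gives the invariance of the form in `IsPrimitive`. -/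
lemma MapsReal.inv_mob_sub {γ : SL(2, ℤ)} {α α' : ℝ} (h : MapsReal γ α α') {z : ℂ}
    (hz : 0 < z.im) :
    (mob γ z - α')⁻¹ * (1 / ((γ 1 0 : ℂ) * z + (γ 1 1 : ℂ)) ^ 2) =
      (z - α)⁻¹ - (γ 1 0 : ℂ) / ((γ 1 0 : ℂ) * z + (γ 1 1 : ℂ)) := by
  obtain ⟨h0, h1⟩ := h
  have hd := denom_ne_zero γ hz
  have hα := sub_real_ne_zero hz α
  have h0' : (γ 1 0 : ℂ) * α + γ 1 1 ≠ 0 := by exact_mod_cast h0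
  have h1' : (α' : ℂ) * ((γ 1 0 : ℂ) * α + γ 1 1) = (γ 0 0 : ℂ) * α + γ 0 1 := by
    exact_mod_cast h1
  have hdet := det_eq_one_complex γ
  have key : mob γ z - α' =
      (z - α) / (((γ 1 0 : ℂ) * z + γ 1 1) * ((γ 1 0 : ℂ) * α + γ 1 1)) := by
    rw [mob]
    generalize hu : (γ 1 0 : ℂ) * z + γ 1 1 = u at *
    generalize hv : (γ 1 0 : ℂ) * α + γ 1 1 = v at *
    field_simp
    rw [← hu, ← hv] at *
    linear_combination (z - α) * hdet - ((γ 1 0 : ℂ) * z + γ 1 1) * h1'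
  have hv : (γ 1 0 : ℂ) * α + γ 1 1 =
      ((γ 1 0 : ℂ) * z + γ 1 1) - (γ 1 0 : ℂ) * (z - α) := by ring
  rw [key, inv_div]
  rw [hv] at h0' ⊢
  generalize (γ 1 0 : ℂ) * z + γ 1 1 = u at *
  field_simp

lemma IsPrimitive.comp_mob (hg : IsInvariantHolomorphic g) {γ : SL(2, ℤ)} {α α' β β' : ℝ}
    (hα : MapsReal γ α α') (hβ : MapsReal γ β β') {F : ℂ → ℂ} (hF : IsPrimitive g α' β' F) :
    IsPrimitive g α β (F ∘ mob γ) := fun z hz => by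
  refine ((hF _ (mob_im_pos γ hz)).comp z (hasDerivAt_mob γ hz)).congr_deriv ?_
  rw [hg.inv γ z hz, mul_assoc, sub_mul, hα.inv_mob_sub hz, hβ.inv_mob_sub hz]
  ring

/-- The integral of `g(z) (1 / (z - α) - 1 / (z - β)) dz` from `p` to `q` in the upper half
plane. -/
noncomputable def lineInt (g : ℂ → ℂ) (α β : ℝ) (p q : ℂ) : ℂ :=
  Classical.epsilon (IsPrimitive g α β) q - Classical.epsilon (IsPrimitive g α β) p

lemma IsPrimitive.lineInt_eq {α β : ℝ} {F : ℂ → ℂ} (hF : IsPrimitive g α β F) {p q : ℂ}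
    (hp : 0 < p.im) (hq : 0 < q.im) : lineInt g α β p q = F q - F p :=
  (Classical.epsilon_spec (p := IsPrimitive g α β) ⟨F, hF⟩).sub_eq_sub hF hq hp

lemma lineInt_add (g : ℂ → ℂ) (α β : ℝ) (p q r : ℂ) :
    lineInt g α β p q + lineInt g α β q r = lineInt g α β p r := by
  simp only [lineInt]; ring

lemma lineInt_symm (g : ℂ → ℂ) (α β : ℝ) (p q : ℂ) :
    lineInt g α β p q = -lineInt g α β q p := by
  simp only [lineInt]; ring

lemma lineInt_mob (hg : IsInvariantHolomorphic g) {γ : SL(2, ℤ)} {α α' β β' : ℝ}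
    (hα : MapsReal γ α α') (hβ : MapsReal γ β β') {p q : ℂ} (hp : 0 < p.im) (hq : 0 < q.im) :
    lineInt g α' β' (mob γ p) (mob γ q) = lineInt g α β p q := by
  obtain ⟨F, hF⟩ := hg.exists_isPrimitive α' β'
  rw [hF.lineInt_eq (mob_im_pos γ hp) (mob_im_pos γ hq),
    (hF.comp_mob hg hα hβ).lineInt_eq hp hq]
  rfl

/-- The integral from `γ z` to `z`, for `γ` fixing `α` and `β`, does not depend on `z`. -/
lemma lineInt_mob_self_eq (hg : IsInvariantHolomorphic g) {γ : SL(2, ℤ)} {α β : ℝ}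
    (hα : MapsReal γ α α) (hβ : MapsReal γ β β) {p q : ℂ} (hp : 0 < p.im) (hq : 0 < q.im) :
    lineInt g α β (mob γ p) p = lineInt g α β (mob γ q) q := by
  have h := lineInt_mob hg hα hβ hp hq
  rw [← lineInt_add g α β (mob γ p) q p, ← lineInt_add g α β (mob γ p) (mob γ q) q, h,
    lineInt_symm g α β q p]
  ring

/-! ### Means along a geodesic -/

/-- A continuous function on `ℝ` that is quasi-periodic for two periods has the same mean slope
for both. -/
lemma quasiPeriodic_slope_eq {G : ℝ → ℂ} (hG : Continuous G) {T₁ T₂ : ℝ} (hT₁ : T₁ ≠ 0)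
    (hT₂ : T₂ ≠ 0) {c₁ c₂ : ℂ} (h₁ : ∀ s, G (s + T₁) = G s + c₁)
    (h₂ : ∀ s, G (s + T₂) = G s + c₂) : c₁ / T₁ = c₂ / T₂ := by
  -- After subtraction of its mean slope `G` is periodic and continuous, hence bounded; two linear
  -- functions at bounded distance from `G` have equal slopes.
  have bdd : ∀ {T : ℝ} {c : ℂ}, T ≠ 0 → (∀ s, G (s + T) = G s + c) →
      ∃ C, ∀ s : ℝ, ‖G s - c / T * s‖ ≤ C := by
    intro T c hT h
    have hT' : (T : ℂ) ≠ 0 := by exact_mod_cast hT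
    have hp : Function.Periodic (fun s : ℝ => G s - c / T * s) T := fun s => by
      simp only [h, ofReal_add]
      field_simp
      ring
    have hc := (hp.compact_of_continuous hT (by fun_prop)).isBounded
    obtain ⟨C, hC⟩ := hc.exists_norm_le
    exact ⟨C, fun s => hC _ ⟨s, rfl⟩⟩
  obtain ⟨C₁, hC₁⟩ := bdd hT₁ h₁
  obtain ⟨C₂, hC₂⟩ := bdd hT₂ h₂
  by_contra hne
  have hpos : 0 < ‖c₁ / T₁ - c₂ / T₂‖ := norm_pos_iff.mpr (sub_ne_zero.mpr hne)
  have key : ∀ s : ℝ, 0 ≤ s → ‖c₁ / T₁ - c₂ / T₂‖ * s ≤ C₁ + C₂ := fun s hs => by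
    have : (c₁ / T₁ - c₂ / T₂) * s = (G s - c₂ / T₂ * s) - (G s - c₁ / T₁ * s) := by ring
    calc ‖c₁ / T₁ - c₂ / T₂‖ * s = ‖(c₁ / T₁ - c₂ / T₂) * s‖ := by
          rw [norm_mul, norm_real, Real.norm_of_nonneg hs]
      _ ≤ C₂ + C₁ := by rw [this]; exact (norm_sub_le _ _).trans (add_le_add (hC₂ s) (hC₁ s))
      _ = _ := add_comm _ _
  have h0 : 0 ≤ C₁ + C₂ := by simpa using key 0 le_rfl
  have := key ((C₁ + C₂ + 1) / ‖c₁ / T₁ - c₂ / T₂‖) (by positivity)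
  rw [mul_div_cancel₀ _ hpos.ne'] at this
  linarith

/-- The point `z` with `(z - α) / (z - β) = i exp s` of the geodesic with end points `α, β`. -/
noncomputable def geodesic (α β s : ℝ) : ℂ :=
  (α - I * Real.exp s * β) / (1 - I * Real.exp s)

lemma one_sub_I_mul_ne_zero (r : ℝ) : (1 : ℂ) - I * r ≠ 0 := fun h => by
  have := congrArg Complex.re h
  simp at this

lemma geodesic_im_pos {α β : ℝ} (h : β < α) (s : ℝ) : 0 < (geodesic α β s).im := by
  have hn : 0 < normSq (1 - I * Real.exp s) := normSq_pos.mpr (one_sub_I_mul_ne_zero _)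
  rw [geodesic, div_im]
  have h1 : ((α : ℂ) - I * Real.exp s * β).im = -(Real.exp s * β) := by
    simp [-ofReal_exp]
  have h2 : ((α : ℂ) - I * Real.exp s * β).re = α := by simp [-ofReal_exp]
  have h3 : ((1 : ℂ) - I * Real.exp s).im = -Real.exp s := by simp [-ofReal_exp]
  have h4 : ((1 : ℂ) - I * Real.exp s).re = 1 := by simp [-ofReal_exp]
  rw [h1, h2, h3, h4, ← sub_div]
  apply div_pos _ hn
  nlinarith [mul_pos (Real.exp_pos s) (sub_pos.mpr h)]

lemma continuous_geodesic (α β : ℝ) : Continuous (geodesic α β) := by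
  unfold geodesic
  have : ∀ s : ℝ, (1 : ℂ) - I * Real.exp s ≠ 0 := fun s => one_sub_I_mul_ne_zero _
  fun_prop (disch := exact this _)

/-- A real Möbius transformation with fixed points `α`, `β` translates along the geodesic. -/
lemma moebius_geodesic {α β a b c d s T : ℝ} (hα : α * (c * α + d) = a * α + b)
    (hβ : β * (c * β + d) = a * β + b)
    (hT : (c * β + d) * Real.exp T = c * α + d) (hden : (c : ℂ) * geodesic α β (s + T) + d ≠ 0) :
    ((a : ℂ) * geodesic α β (s + T) + b) / ((c : ℂ) * geodesic α β (s + T) + d) =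
      geodesic α β s := by
  have e1 := one_sub_I_mul_ne_zero (Real.exp (s + T))
  have e2 := one_sub_I_mul_ne_zero (Real.exp s)
  have hα' : (α : ℂ) * (c * α + d) = a * α + b := by exact_mod_cast hα
  have hβ' : (β : ℂ) * (c * β + d) = a * β + b := by exact_mod_cast hβ
  have hT' : ((c : ℂ) * β + d) * (Real.exp T : ℝ) = c * α + d := by exact_mod_cast hT
  unfold geodesic at *
  rw [Real.exp_add, ofReal_mul] at *
  generalize (Real.exp s : ℂ) = x at *
  generalize (Real.exp T : ℂ) = y at *
  have hnum : (a : ℂ) * ((α - I * (x * y) * β) / (1 - I * (x * y))) + b =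
      (c * α + d) * (α - I * x * β) / (1 - I * (x * y)) := by
    rw [eq_div_iff e1, add_mul, mul_assoc, div_mul_cancel₀ _ e1]
    linear_combination -hα' + I * x * y * hβ' - I * x * β * hT'
  have hdenom : (c : ℂ) * ((α - I * (x * y) * β) / (1 - I * (x * y))) + d =
      (c * α + d) * (1 - I * x) / (1 - I * (x * y)) := by
    rw [eq_div_iff e1, add_mul, mul_assoc, div_mul_cancel₀ _ e1]
    linear_combination -I * x * hT'
  rw [hnum, hdenom, div_div_div_cancel_right₀ e1]
  rw [hdenom, div_ne_zero_iff] at hden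
  exact mul_div_mul_left _ _ (left_ne_zero_of_mul hden.1)

/-- The mean of `g` along the geodesic between two quadratic irrationalities can be computed with
any hyperbolic element of the modular group that fixes them. -/
lemma lineInt_div_log_eq (hg : IsInvariantHolomorphic g) {α β : ℝ} (hβα : β < α)
    {γ δ : SL(2, ℤ)} (hγα : MapsReal γ α α) (hγβ : MapsReal γ β β) (hδα : MapsReal δ α α)
    (hδβ : MapsReal δ β β) {S T : ℝ} (hS : S ≠ 0) (hT : T ≠ 0)
    (hγS : ((γ 1 0 : ℝ) * β + γ 1 1) * Real.exp S = (γ 1 0 : ℝ) * α + γ 1 1)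
    (hδT : ((δ 1 0 : ℝ) * β + δ 1 1) * Real.exp T = (δ 1 0 : ℝ) * α + δ 1 1)
    {p q : ℂ} (hp : 0 < p.im) (hq : 0 < q.im) :
    lineInt g α β (mob γ p) p / S = lineInt g α β (mob δ q) q / T := by
  obtain ⟨F, hF⟩ := hg.exists_isPrimitive α β
  have hpos := geodesic_im_pos hβα
  have hcont : Continuous fun s => F (geodesic α β s) :=
    continuous_iff_continuousAt.mpr fun s =>
      (hF _ (hpos s)).continuousAt.comp (continuous_geodesic α β).continuousAt
  -- `γ` translates the geodesic parameter by `-S`, so a primitive along the geodesic is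
  -- quasi-periodic, with the integral from `γ p` to `p` as increment.
  have shift : ∀ {γ : SL(2, ℤ)} {S : ℝ}, MapsReal γ α α → MapsReal γ β β →
      ((γ 1 0 : ℝ) * β + γ 1 1) * Real.exp S = (γ 1 0 : ℝ) * α + γ 1 1 →
      ∀ {p : ℂ}, 0 < p.im → ∀ s, F (geodesic α β (s + S)) = F (geodesic α β s) +
        lineInt g α β (mob γ p) p := by
    intro γ S hα hβ hS p hp s
    have hm : mob γ (geodesic α β (s + S)) = geodesic α β s := by
      have := denom_ne_zero γ (hpos (s + S))
      have h := moebius_geodesic (a := γ 0 0) (b := γ 0 1) (c := γ 1 0) (d := γ 1 1) (s := s)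
        hα.2 hβ.2 hS (by simpa using this)
      simpa [mob] using h
    rw [lineInt_mob_self_eq hg hα hβ hp (hpos (s + S)), hm,
      hF.lineInt_eq (hpos s) (hpos _)]
    ring
  exact quasiPeriodic_slope_eq hcont hS hT (shift hγα hγβ hγS hp) (shift hδα hδβ hδT hq)

/-! ### The Pell equation and the generator of the stabilizer -/

namespace IntForm

variable {Q : IntForm}

lemma exists_pell (hD : 0 < Q.disc) (hsq : ¬IsSquare Q.disc) :
    ∃ u : ℕ, 0 < u ∧ ∃ t : ℕ, (t : ℤ) ^ 2 - Q.disc * (u : ℤ) ^ 2 = 4 := by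
  obtain ⟨x, y, hxy, hy⟩ := Pell.exists_of_not_isSquare hD hsq
  refine ⟨2 * y.natAbs, by positivity, 2 * x.natAbs, ?_⟩
  push_cast
  rw [mul_pow, mul_pow, sq_abs, sq_abs]
  linear_combination 4 * hxy

lemma pell_spec (hD : 0 < Q.disc) (hsq : ¬IsSquare Q.disc) :
    0 < Q.pellU ∧ 0 < Q.pellT ∧ (Q.pellT : ℤ) ^ 2 - Q.disc * (Q.pellU : ℤ) ^ 2 = 4 := by
  have hU : Q.pellU ∈ {u : ℕ | 0 < u ∧ ∃ t : ℕ, (t : ℤ) ^ 2 - Q.disc * (u : ℤ) ^ 2 = 4} :=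
    Nat.sInf_mem (exists_pell hD hsq)
  obtain ⟨hu, t, ht⟩ := hU
  have hT : Q.pellT ∈ {t : ℕ | 0 < t ∧ (t : ℤ) ^ 2 - Q.disc * (Q.pellU : ℤ) ^ 2 = 4} := by
    refine Nat.sInf_mem ⟨t, ?_, ht⟩
    rcases Nat.eq_zero_or_pos t with h | h
    · subst h
      have : 0 < Q.disc * (Q.pellU : ℤ) ^ 2 := by positivity
      simp at ht
      linarith
    · exact h
  exact ⟨hu, hT.1, hT.2⟩

/-- The generator `A_w` as an element of the modular group. -/
lemma exists_stab_eq (hD : 0 < Q.disc) (hsq : ¬IsSquare Q.disc) :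
    ∃ δ : SL(2, ℤ), ((δ 0 0 : ℤ) : ℝ) = ((Q.pellT : ℝ) - Q.b * Q.pellU) / 2 ∧
      ((δ 0 1 : ℤ) : ℝ) = -(Q.c : ℝ) * Q.pellU ∧ ((δ 1 0 : ℤ) : ℝ) = (Q.a : ℝ) * Q.pellU ∧
      ((δ 1 1 : ℤ) : ℝ) = ((Q.pellT : ℝ) + Q.b * Q.pellU) / 2 := by
  obtain ⟨-, -, h⟩ := pell_spec hD hsq
  rw [disc] at h
  generalize Q.pellT = t at *
  generalize Q.pellU = u at *
  -- The factors `t - bu` and `t + bu` have the same parity, and their product is even because `D ≡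
  -- b² mod 4`.
  have hpar : ((t : ℤ) - Q.b * u) % 2 = 0 := by
    have h1 : ((t : ℤ) - Q.b * u) * (t + Q.b * u) = 2 * (2 - 2 * Q.a * Q.c * u ^ 2) := by
      linear_combination h
    have h2 : Even (((t : ℤ) - Q.b * u) * (t + Q.b * u)) := ⟨_, h1.trans (two_mul _)⟩
    rcases Int.even_mul.mp h2 with h3 | h3
    · exact Int.even_iff.mp h3
    · rw [Int.even_iff] at h3; omega
  obtain ⟨k, hk⟩ : ∃ k, (t : ℤ) - Q.b * u = 2 * k := ⟨((t : ℤ) - Q.b * u) / 2, by omega⟩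
  have hkR : (t : ℝ) - Q.b * u = 2 * k := by exact_mod_cast hk
  refine ⟨⟨!![k, -Q.c * u; Q.a * u, k + Q.b * u], ?_⟩, ?_, ?_, ?_, ?_⟩
  · rw [Matrix.det_fin_two_of]
    have h4 : 4 * (k * (k + Q.b * u) - -Q.c * u * (Q.a * u)) = 4 * 1 := by
      linear_combination h - (t + Q.b * u + 2 * k) * hk
    linarith
  · simp; linarith
  · simp
  · simp
  · simp; linarith

end IntForm

/-! ### Cycle integrals as line integrals -/

lemma norm_geodesic_sub {α β : ℝ} (h : β < α) (s : ℝ) :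
    ‖geodesic α β s - ((α + β) / 2 : ℝ)‖ = (α - β) / 2 := by
  have e := one_sub_I_mul_ne_zero (Real.exp s)
  have hn : ‖(1 : ℂ) + I * Real.exp s‖ = ‖(1 : ℂ) - I * Real.exp s‖ := by
    rw [← norm_conj ((1 : ℂ) + _)]
    congr 1
    simp only [map_add, map_one, map_mul, conj_I, conj_ofReal]
    ring
  have : geodesic α β s - ((α + β) / 2 : ℝ) =
      ((α - β) / 2 : ℝ) * ((1 + I * Real.exp s) / (1 - I * Real.exp s)) := by
    unfold geodesic
    push_cast
    rw [← ofReal_exp]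
    generalize (Real.exp s : ℂ) = x at *
    field_simp
    ring
  rw [this, norm_mul, norm_div, hn, div_self (norm_ne_zero_iff.mpr e), mul_one, norm_real,
    Real.norm_of_nonneg (by linarith)]

lemma arg_mem_Ioo_of_im_pos {z : ℂ} (hz : 0 < z.im) : z.arg ∈ Set.Ioo 0 Real.pi := by
  refine ⟨lt_of_le_of_ne (arg_nonneg_iff.mpr hz.le) fun h => ?_,
    arg_lt_pi_iff.mpr (Or.inr hz.ne')⟩
  exact hz.ne' (arg_eq_zero_iff.mp h.symm).2

namespace IntForm

variable {Q : IntForm}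

lemma hasDerivAt_point (Q : IntForm) (θ : ℝ) :
    HasDerivAt Q.point (Q.radius * (exp (θ * I) * I)) θ := by
  have h1 : HasDerivAt (fun θ : ℝ => (θ : ℂ) * I) I θ := by
    simpa using (ofRealCLM.hasDerivAt (x := θ)).mul_const I
  exact (h1.cexp.const_mul (Q.radius : ℂ)).const_add (Q.center : ℂ)

/-- The roots of a form with positive leading coefficient, and its geodesic. -/
structure Roots (Q : IntForm) (α β : ℝ) : Prop where
  pos : 0 < Q.a
  disc_pos : 0 < Q.disc
  left : α = (-(Q.b : ℝ) + √(Q.disc : ℝ)) / (2 * (Q.a : ℝ))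
  right : β = (-(Q.b : ℝ) - √(Q.disc : ℝ)) / (2 * (Q.a : ℝ))

namespace Roots

variable {α β : ℝ}

lemma a_pos (h : Q.Roots α β) : (0 : ℝ) < Q.a := by exact_mod_cast h.pos

lemma sqrt_pos (h : Q.Roots α β) : 0 < √(Q.disc : ℝ) := Real.sqrt_pos.mpr (by exact_mod_cast h.disc_pos)

lemma lt (h : Q.Roots α β) : β < α := by
  rw [h.left, h.right]
  have := h.a_pos
  have := h.sqrt_pos
  gcongr
  linarith

lemma two_mul_left (h : Q.Roots α β) : 2 * (Q.a : ℝ) * α = -Q.b + √(Q.disc : ℝ) := by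
  have := h.a_pos
  rw [h.left]; field_simp

lemma two_mul_right (h : Q.Roots α β) : 2 * (Q.a : ℝ) * β = -Q.b - √(Q.disc : ℝ) := by
  have := h.a_pos
  rw [h.right]; field_simp

lemma sqrt_eq (h : Q.Roots α β) : √(Q.disc : ℝ) = Q.a * (α - β) := by
  linarith [h.two_mul_left, h.two_mul_right]

lemma b_eq (h : Q.Roots α β) : (Q.b : ℝ) = -Q.a * (α + β) := by
  linarith [h.two_mul_left, h.two_mul_right]

lemma disc_eq (h : Q.Roots α β) : (Q.disc : ℝ) = (Q.a * (α - β)) ^ 2 := by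
  rw [← h.sqrt_eq, Real.sq_sqrt (by exact_mod_cast h.disc_pos.le)]

lemma c_eq (h : Q.Roots α β) : (Q.c : ℝ) = Q.a * (α * β) := by
  have h1 := h.disc_eq
  have ha := h.a_pos
  simp only [disc, Int.cast_sub, Int.cast_pow, Int.cast_mul, Int.cast_ofNat, h.b_eq] at h1
  have : (4 * Q.a : ℝ) * Q.c = (4 * Q.a) * (Q.a * (α * β)) := by linear_combination -h1
  exact mul_left_cancel₀ (by positivity) this

lemma center_eq (h : Q.Roots α β) : Q.center = (α + β) / 2 := by
  have := h.a_pos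
  rw [center, h.b_eq]; field_simp

lemma radius_eq (h : Q.Roots α β) : Q.radius = (α - β) / 2 := by
  have := h.a_pos
  rw [radius, h.sqrt_eq, abs_of_pos this]; field_simp

lemma eval_eq (h : Q.Roots α β) (z : ℂ) : Q.eval z = Q.a * (z - α) * (z - β) := by
  have hb : (Q.b : ℂ) = -Q.a * (α + β) := by exact_mod_cast h.b_eq
  have hc : (Q.c : ℂ) = Q.a * (α * β) := by exact_mod_cast h.c_eq
  rw [eval, hb, hc]; ring

lemma point_arg (h : Q.Roots α β) {s : ℝ} : Q.point (geodesic α β s - Q.center).arg = geodesic α β s := by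
  rw [point, h.radius_eq, h.center_eq, ← norm_geodesic_sub h.lt s, norm_mul_exp_arg_mul_I]
  ring

lemma point_pi_div_two (h : Q.Roots α β) : Q.point (Real.pi / 2) = geodesic α β 0 := by
  have e : (1 : ℂ) - I ≠ 0 := by simpa using one_sub_I_mul_ne_zero 1
  rw [point, h.radius_eq, h.center_eq, geodesic]
  push_cast
  rw [exp_pi_div_two_mul_I, exp_zero, mul_one, eq_div_iff e]
  linear_combination (-(α - β) / 2 : ℂ) * I_sq

lemma point_im_pos (h : Q.Roots α β) {θ : ℝ} (hθ : θ ∈ Set.Ioo 0 Real.pi) : 0 < (Q.point θ).im := by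
  have hr : 0 < Q.radius := by rw [h.radius_eq]; linarith [h.lt]
  simp only [point, add_im, ofReal_im, mul_im, ofReal_re, exp_ofReal_mul_I_im, zero_mul,
    add_zero, zero_add]
  exact mul_pos hr (Real.sin_pos_of_mem_Ioo hθ)

lemma integrand_eq (h : Q.Roots α β) {z : ℂ} (hz : 0 < z.im) (v : ℂ) :
    ((√(Q.disc : ℝ) : ℝ) : ℂ) * v / Q.eval z = v * ((z - α)⁻¹ - (z - β)⁻¹) := by
  have ha : (Q.a : ℂ) ≠ 0 := by exact_mod_cast h.pos.ne'
  have h1 := sub_real_ne_zero hz α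
  have h2 := sub_real_ne_zero hz β
  rw [h.eval_eq, h.sqrt_eq]
  push_cast
  field_simp
  ring

lemma integral_point_eq (h : Q.Roots α β) {f : ℍ → ℂ} (hf : IsModularFunction f) {θ₀ θ₁ : ℝ}
    (h₀ : θ₀ ∈ Set.Ioo 0 Real.pi) (h₁ : θ₁ ∈ Set.Ioo 0 Real.pi) :
    ∫ θ in θ₀..θ₁, ((√(Q.disc : ℝ) : ℝ) : ℂ) * f (UpperHalfPlane.ofComplex (Q.point θ)) /
        Q.eval (Q.point θ) * deriv Q.point θ =
      lineInt (fun z => f (UpperHalfPlane.ofComplex z)) α β (Q.point θ₀) (Q.point θ₁) := by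
  have hg := hf.isInvariantHolomorphic
  set g : ℂ → ℂ := fun z => f (UpperHalfPlane.ofComplex z) with hgdef
  obtain ⟨F, hF⟩ := hg.exists_isPrimitive α β
  have hsub : ∀ θ ∈ Set.uIcc θ₀ θ₁, 0 < (Q.point θ).im := fun θ hθ =>
    h.point_im_pos (Set.ordConnected_Ioo.uIcc_subset h₀ h₁ hθ)
  have hpt : Continuous Q.point := by unfold point; fun_prop
  rw [hF.lineInt_eq (h.point_im_pos h₀) (h.point_im_pos h₁)]
  have hd : ∀ θ ∈ Set.uIcc θ₀ θ₁, HasDerivAt (F ∘ Q.point)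
      (g (Q.point θ) * ((Q.point θ - α)⁻¹ - (Q.point θ - β)⁻¹) *
        (Q.radius * (exp (θ * I) * I))) θ := fun θ hθ =>
    (hF _ (hsub θ hθ)).comp θ (Q.hasDerivAt_point θ)
  rw [intervalIntegral.integral_congr (g := fun θ : ℝ => g (Q.point θ) *
      ((Q.point θ - α)⁻¹ - (Q.point θ - β)⁻¹) * (Q.radius * (exp (θ * I) * I)))]
  · rw [intervalIntegral.integral_eq_sub_of_hasDerivAt hd]
    · rfl
    · apply ContinuousOn.intervalIntegrable
      have hgc : ContinuousOn (fun θ => g (Q.point θ)) (Set.uIcc θ₀ θ₁) :=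
        hg.diff.continuousOn.comp hpt.continuousOn hsub
      have hi : ∀ a : ℝ, ContinuousOn (fun θ => (Q.point θ - a)⁻¹) (Set.uIcc θ₀ θ₁) := fun a =>
        ContinuousOn.inv₀ (by fun_prop) fun θ hθ => sub_real_ne_zero (hsub θ hθ) a
      exact (hgc.mul ((hi α).sub (hi β))).mul (by fun_prop)
  · intro θ hθ
    simp only
    rw [h.integrand_eq (hsub θ hθ), (Q.hasDerivAt_point θ).deriv]

lemma unit_eq (h : Q.Roots α β) : Q.unit = (Q.pellT + Q.pellU * (Q.a * (α - β))) / 2 := by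
  rw [unit, h.sqrt_eq]

lemma unit_mul (h : Q.Roots α β) (hsq : ¬IsSquare Q.disc) :
    Q.unit * ((Q.pellT - Q.pellU * (Q.a * (α - β))) / 2) = 1 := by
  have h1 := (pell_spec h.disc_pos hsq).2.2
  have h2 : (Q.pellT : ℝ) ^ 2 - Q.disc * (Q.pellU : ℝ) ^ 2 = 4 := by exact_mod_cast h1
  rw [h.disc_eq] at h2
  rw [h.unit_eq]
  linear_combination h2 / 4

lemma one_lt_unit (h : Q.Roots α β) (hsq : ¬IsSquare Q.disc) : 1 < Q.unit := by
  have h0 := h.unit_mul hsq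
  obtain ⟨hu, ht, -⟩ := pell_spec h.disc_pos hsq
  have hu' : (0 : ℝ) < Q.pellU := by exact_mod_cast hu
  have ht' : (0 : ℝ) < Q.pellT := by exact_mod_cast ht
  have hx : 0 < Q.pellU * (Q.a * (α - β)) :=
    mul_pos hu' (mul_pos h.a_pos (sub_pos.mpr h.lt))
  rw [h.unit_eq] at h0 ⊢
  nlinarith

/-- The denominators of `A_w⁻¹` at `β` and `α` are `ε` and `ε⁻¹`, so it moves the parameter forward
by `2 log ε`: `C_w` is oriented by increasing parameter. -/
lemma moebius_stab_inv (h : Q.Roots α β) (hsq : ¬IsSquare Q.disc) :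
    moebius (Q.stab)⁻¹ (geodesic α β 0) = geodesic α β (2 * Real.log Q.unit) := by
  have h0 := h.unit_mul hsq
  have h1 := h.one_lt_unit hsq
  obtain ⟨hu, ht, hP⟩ := pell_spec h.disc_pos hsq
  have hP' : (Q.pellT : ℝ) ^ 2 - (Q.a * (α - β)) ^ 2 * (Q.pellU : ℝ) ^ 2 = 4 := by
    rw [← h.disc_eq]; exact_mod_cast hP
  have hinv : (Q.stab)⁻¹ = !![((Q.pellT : ℝ) + Q.b * Q.pellU) / 2, (Q.c : ℝ) * Q.pellU;
     -(Q.a : ℝ) * Q.pellU, ((Q.pellT : ℝ) - Q.b * Q.pellU) / 2] := by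
    apply Matrix.inv_eq_right_inv
    rw [stab, h.b_eq, h.c_eq, Matrix.mul_fin_two, Matrix.one_fin_two]
    congr 1
    ext i j
    fin_cases i <;> fin_cases j
    · simp; linear_combination hP' / 4
    · simp; ring
    · simp; ring
    · simp; linear_combination hP' / 4
  have hexp : Real.exp (-(2 * Real.log Q.unit)) * Q.unit ^ 2 = 1 := by
    rw [show -(2 * Real.log Q.unit) = -Real.log Q.unit + -Real.log Q.unit by ring,
      Real.exp_add, Real.exp_neg, Real.exp_log (by linarith)]
    have : Q.unit ≠ 0 := by positivity
    field_simp
  have hu' : (Q.pellU : ℝ) ≠ 0 := by exact_mod_cast hu.ne'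
  have key := moebius_geodesic (α := α) (β := β) (a := ((Q.pellT : ℝ) + Q.b * Q.pellU) / 2)
    (b := (Q.c : ℝ) * Q.pellU) (c := -(Q.a : ℝ) * Q.pellU)
    (d := ((Q.pellT : ℝ) - Q.b * Q.pellU) / 2) (s := 2 * Real.log Q.unit)
    (T := -(2 * Real.log Q.unit))
    (by rw [h.b_eq, h.c_eq]; ring) (by rw [h.b_eq, h.c_eq]; ring)
    (by
      rw [h.b_eq]
      have e1 : -(Q.a : ℝ) * Q.pellU * β + (Q.pellT - -Q.a * (α + β) * Q.pellU) / 2 = Q.unit := by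
        rw [h.unit_eq]; ring
      have e2 : -(Q.a : ℝ) * Q.pellU * α + (Q.pellT - -Q.a * (α + β) * Q.pellU) / 2 =
          (Q.pellT - Q.pellU * (Q.a * (α - β))) / 2 := by ring
      rw [e1, e2]
      apply mul_left_cancel₀ (show Q.unit ≠ 0 by positivity)
      linear_combination hexp - h0)
    (by
      intro hz
      have := congrArg Complex.im hz
      simp only [add_im, mul_im, ofReal_re, ofReal_im, zero_mul, add_zero, zero_im] at this
      refine mul_ne_zero (mul_ne_zero (neg_ne_zero.mpr h.a_pos.ne') hu')
        (geodesic_im_pos h.lt _).ne' this)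
  rw [add_neg_cancel] at key
  rw [hinv, moebius, ← key]
  simp

lemma cycleIntegral_eq (h : Q.Roots α β) (hsq : ¬IsSquare Q.disc) {f : ℍ → ℂ} (hf : IsModularFunction f) :
    Q.cycleIntegral f = lineInt (fun z => f (UpperHalfPlane.ofComplex z)) α β
      (geodesic α β 0) (geodesic α β (2 * Real.log Q.unit)) := by
  have hend : Q.endAngle = (geodesic α β (2 * Real.log Q.unit) - Q.center).arg := by
    rw [endAngle, h.point_pi_div_two, h.moebius_stab_inv hsq]
  rw [cycleIntegral, h.integral_point_eq hf, hend, h.point_arg, h.point_pi_div_two]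
  · constructor <;> linarith [Real.pi_pos]
  · rw [hend]
    apply arg_mem_Ioo_of_im_pos
    simpa using geodesic_im_pos h.lt _

end Roots

end IntForm

/-! ### The primitive form of a quadratic irrationality -/

lemma IntForm.HasRoot.eq_zero {Q : IntForm} {w : ℝ} (h : Q.HasRoot w) :
    (Q.a : ℝ) * w ^ 2 + Q.b * w + Q.c = 0 := by
  obtain ⟨ha, -, hD, hw⟩ := h
  have ha' : (Q.a : ℝ) ≠ 0 := by exact_mod_cast ha
  have h1 : 2 * (Q.a : ℝ) * w = -Q.b + √(Q.disc : ℝ) := by rw [hw]; field_simp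
  have h2 : √(Q.disc : ℝ) ^ 2 = Q.disc := Real.sq_sqrt (by exact_mod_cast hD.le)
  rw [IntForm.disc] at h1 h2
  push_cast at h1 h2
  have h3 : (4 * (Q.a : ℝ)) * (Q.a * w ^ 2 + Q.b * w + Q.c) = 0 := by
    rw [show √((Q.b : ℝ) ^ 2 - 4 * Q.a * Q.c) = 2 * (Q.a : ℝ) * w + Q.b by linarith] at h2
    linear_combination h2
  exact (mul_eq_zero.mp h3).resolve_left (by positivity)

lemma IntForm.HasRoot.not_isSquare {Q : IntForm} {w : ℝ} (h : Q.HasRoot w) (hw : Irrational w) :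
    ¬IsSquare Q.disc := by
  rintro ⟨s, hs⟩
  obtain ⟨ha, -, hD, hw'⟩ := h
  refine hw ⟨(-Q.b + |s|) / (2 * Q.a), ?_⟩
  rw [hw', hs]
  push_cast
  rw [Real.sqrt_mul_self_eq_abs]

/-- An irrational root of an integral form of positive discriminant, the larger one, is the root
of a primitive form. -/
lemma exists_hasRoot {a b c : ℤ} {α β : ℝ} (ha : 0 < a) (hβα : β < α)
    (hα : (a : ℝ) * α ^ 2 + b * α + c = 0) (hβ : (a : ℝ) * β ^ 2 + b * β + c = 0) :
    ∃ Q : IntForm, Q.HasRoot α := by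
  obtain ⟨k, hk⟩ : ∃ k : ℤ, k = Int.gcd (Int.gcd a b) c := ⟨_, rfl⟩
  have hk0 : 0 < k := by
    rw [hk]
    have : 0 < Int.gcd (Int.gcd a b) c := by
      apply Int.gcd_pos_of_ne_zero_left
      exact_mod_cast (Int.gcd_pos_of_ne_zero_left b ha.ne').ne'
    exact_mod_cast this
  have hkab : k ∣ Int.gcd a b := hk ▸ Int.gcd_dvd_left ..
  obtain ⟨a', rfl⟩ := hkab.trans (Int.gcd_dvd_left ..)
  obtain ⟨b', rfl⟩ := hkab.trans (Int.gcd_dvd_right ..)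
  obtain ⟨c', rfl⟩ : k ∣ c := hk ▸ Int.gcd_dvd_right ..
  have hkR : (0 : ℝ) < k := by exact_mod_cast hk0
  have ha' : 0 < a' := pos_of_mul_pos_right ha hk0.le
  have haR : (0 : ℝ) < a' := by exact_mod_cast ha'
  have hα' : (a' : ℝ) * α ^ 2 + b' * α + c' = 0 := by
    push_cast at hα
    apply mul_left_cancel₀ hkR.ne'
    linear_combination hα
  have hβ' : (a' : ℝ) * β ^ 2 + b' * β + c' = 0 := by
    push_cast at hβ
    apply mul_left_cancel₀ hkR.ne'
    linear_combination hβ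
  have hb : (b' : ℝ) = -a' * (α + β) := by
    apply mul_left_cancel₀ (sub_ne_zero.mpr hβα.ne')
    linear_combination hα' - hβ'
  have hc : (c' : ℝ) = a' * (α * β) := by rw [hb] at hα'; linear_combination hα'
  have hdisc : ((b' ^ 2 - 4 * a' * c' : ℤ) : ℝ) = (a' * (α - β)) ^ 2 := by
    push_cast; rw [hb, hc]; ring
  have hpos : (0 : ℝ) < a' * (α - β) := mul_pos haR (sub_pos.mpr hβα)
  refine ⟨⟨a', b', c'⟩, ha'.ne', ?_, ?_, ?_⟩
  · have h1 : (Int.gcd (Int.gcd (k * a') (k * b')) (k * c') : ℤ) =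
        k * Int.gcd (Int.gcd a' b') c' := by
      rw [Int.gcd_mul_left, Nat.cast_mul, Int.natCast_natAbs, abs_of_pos hk0,
        Int.gcd_mul_left, Nat.cast_mul, Int.natCast_natAbs, abs_of_pos hk0]
    rw [← hk] at h1
    have h2 : (Int.gcd (Int.gcd a' b') c' : ℤ) = 1 := by
      apply mul_left_cancel₀ hk0.ne'
      rw [← h1, mul_one]
    exact_mod_cast h2
  · have : (0 : ℝ) < ((b' ^ 2 - 4 * a' * c' : ℤ) : ℝ) := by rw [hdisc]; positivity
    exact_mod_cast this
  · simp only [IntForm.disc]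
    rw [hdisc, Real.sqrt_sq hpos.le, hb]
    field_simp
    ring

/-- Two integral forms with a common irrational root are proportional, so have the same roots. -/
lemma conj_root_eq {a b c a' b' c' : ℤ} {α β : ℝ} (hirr : Irrational α) (ha : a ≠ 0) (hβα : β ≠ α)
    (hα : (a : ℝ) * α ^ 2 + b * α + c = 0) (hβ : (a : ℝ) * β ^ 2 + b * β + c = 0)
    (hα' : (a' : ℝ) * α ^ 2 + b' * α + c' = 0) : (b' : ℝ) = -a' * (α + β) := by
  have haR : (a : ℝ) ≠ 0 := by exact_mod_cast ha
  have hb : (b : ℝ) = -a * (α + β) := by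
    apply mul_left_cancel₀ (sub_ne_zero.mpr hβα.symm)
    linear_combination hα - hβ
  have h1 : ((a * b' - a' * b : ℤ) : ℝ) * α + ((a * c' - a' * c : ℤ) : ℝ) = 0 := by
    push_cast
    linear_combination a * hα' - a' * hα
  -- Otherwise the linear relation `h1` would make `α` rational.
  have h2 : a * b' - a' * b = 0 := by
    by_contra hne
    refine hirr ⟨-((a * c' - a' * c : ℤ) : ℚ) / ((a * b' - a' * b : ℤ) : ℚ), ?_⟩
    have hne' : ((a * b' - a' * b : ℤ) : ℝ) ≠ 0 := by exact_mod_cast hne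
    rw [Rat.cast_div, Rat.cast_neg, Rat.cast_intCast, Rat.cast_intCast, div_eq_iff hne']
    linear_combination -h1
  have h3 : (a : ℝ) * b' - a' * b = 0 := by exact_mod_cast h2
  apply mul_left_cancel₀ haR
  rw [hb] at h3
  linear_combination h3

/-- The normalized value as a mean over a translate of any hyperbolic element fixing `α`. -/
theorem valNor_eq {f : ℍ → ℂ} (hf : IsModularFunction f) {γ : SL(2, ℤ)} {α β : ℝ}
    (hirr : Irrational α) (hβα : β < α) (hγ : 0 < γ 1 0) (hα : MapsReal γ α α)
    (hβ : MapsReal γ β β) {S : ℝ} (hS : S ≠ 0)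
    (hγS : ((γ 1 0 : ℝ) * β + γ 1 1) * Real.exp S = (γ 1 0 : ℝ) * α + γ 1 1)
    {p : ℂ} (hp : 0 < p.im) :
    valNor f α =
      lineInt (fun z => f (UpperHalfPlane.ofComplex z)) α β (mob γ p) p / S := by
  -- The fixed points are the roots of the integral form `[γ₁₀, γ₁₁ - γ₀₀, -γ₀₁]`, to which the
  -- primitive form of `α` is proportional.
  have qα : ((γ 1 0 : ℤ) : ℝ) * α ^ 2 + ((γ 1 1 - γ 0 0 : ℤ) : ℝ) * α + ((-γ 0 1 : ℤ) : ℝ) = 0 := by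
    push_cast; linear_combination hα.2
  have qβ : ((γ 1 0 : ℤ) : ℝ) * β ^ 2 + ((γ 1 1 - γ 0 0 : ℤ) : ℝ) * β + ((-γ 0 1 : ℤ) : ℝ) = 0 := by
    push_cast; linear_combination hβ.2
  have hroot : (formOf α).HasRoot α :=
    Classical.epsilon_spec (p := fun Q : IntForm => Q.HasRoot α) (exists_hasRoot hγ hβα qα qβ)
  rw [valNor, val]
  generalize formOf α = Q at hroot
  have hsq := hroot.not_isSquare hirr
  have hb := conj_root_eq hirr hγ.ne' hβα.ne qα qβ hroot.eq_zero
  have ha0 : (Q.a : ℝ) ≠ 0 := by exact_mod_cast hroot.1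
  have hsqrt : √(Q.disc : ℝ) = Q.a * (α - β) := by
    have : 2 * (Q.a : ℝ) * α = -Q.b + √(Q.disc : ℝ) := by
      conv_lhs => rw [hroot.2.2.2]
      field_simp
    linarith
  -- Since `√D = a (α - β)` with `β < α`, the leading coefficient of the primitive form is positive.
  have hroots : Q.Roots α β := by
    have hD := hroot.2.2.1
    have h1 : 0 < √(Q.disc : ℝ) := Real.sqrt_pos.mpr (by exact_mod_cast hD)
    refine ⟨?_, hD, hroot.2.2.2, ?_⟩
    · rw [hsqrt] at h1
      exact_mod_cast pos_of_mul_pos_left h1 (sub_pos.mpr hβα).le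
    · rw [hsqrt, hb]; field_simp; ring
  obtain ⟨δ, h00, h01, h10, h11⟩ := IntForm.exists_stab_eq hroot.2.2.1 hsq
  have hone := hroots.one_lt_unit hsq
  have hmul := hroots.unit_mul hsq
  have hT : 2 * Real.log Q.unit ≠ 0 := by
    have := Real.log_pos hone
    positivity
  have e1 : (δ 1 0 : ℝ) * α + δ 1 1 = Q.unit := by
    rw [h10, h11, hroots.unit_eq, hroots.b_eq]; ring
  have e2 : (δ 1 0 : ℝ) * β + δ 1 1 = (Q.pellT - Q.pellU * (Q.a * (α - β))) / 2 := by
    rw [h10, h11, hroots.b_eq]; ring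
  have hu0 : Q.unit ≠ 0 := by positivity
  have hδα : MapsReal δ α α := by
    refine ⟨by rw [e1]; exact hu0, ?_⟩
    rw [h00, h01, h10, h11, hroots.b_eq, hroots.c_eq]; ring
  have hδβ : MapsReal δ β β := by
    refine ⟨by rw [e2]; exact right_ne_zero_of_mul (hmul.trans_ne one_ne_zero), ?_⟩
    rw [h00, h01, h10, h11, hroots.b_eq, hroots.c_eq]; ring
  have hexp : Real.exp (2 * Real.log Q.unit) = Q.unit ^ 2 := by
    rw [two_mul, Real.exp_add, Real.exp_log (by linarith), sq]
  have hδT : ((δ 1 0 : ℝ) * β + δ 1 1) * Real.exp (2 * Real.log Q.unit) =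
      (δ 1 0 : ℝ) * α + δ 1 1 := by
    rw [e1, e2, hexp]; linear_combination Q.unit * hmul
  have hg := hf.isInvariantHolomorphic
  have hpos := geodesic_im_pos hβα (2 * Real.log Q.unit)
  rw [hroots.cycleIntegral_eq hsq hf,
    lineInt_div_log_eq hg hβα hα hβ hδα hδβ hS hT hγS hδT hp hpos]
  congr 2
  have hd := denom_ne_zero δ hpos
  have h := moebius_geodesic (a := δ 0 0) (b := δ 0 1) (c := δ 1 0) (d := δ 1 1) (s := 0)
    hδα.2 hδβ.2 hδT (by simpa using hd)
  rw [zero_add] at h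
  simpa [mob] using h.symm

/-! ### Periodic continued fractions and matrices -/

/-- A sequence of complete quotients determines the continued fraction. -/
lemma regularCF_eq_of {a : ℕ → ℕ} {w : ℕ → ℝ} (hw : ∀ k, w k = a k + 1 / w (k + 1))
    (h1 : ∀ k, 1 < w k) : regularCF a = GenContFract.of (w 0) := by
  have hfl : ∀ k, ⌊w k⌋ = (a k : ℤ) := fun k => by
    rw [Int.floor_eq_iff, hw k]
    have := h1 (k + 1)
    have h3 : 1 / w (k + 1) < 1 := by rw [div_lt_one (by linarith)]; exact this
    have h4 : 0 < 1 / w (k + 1) := by positivity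
    push_cast
    constructor <;> linarith
  have hfr : ∀ k, Int.fract (w k) = 1 / w (k + 1) := fun k => by
    rw [Int.fract, hfl, hw k]; push_cast; ring
  have hs : ∀ n k, (GenContFract.of (w k)).s.get? n = some ⟨1, (a (k + n + 1) : ℝ)⟩ := by
    intro n
    induction n with
    | zero =>
      intro k
      have h0 : Int.fract (w k) ≠ 0 := by
        rw [hfr]; have := h1 (k + 1); positivity
      have := GenContFract.of_s_head h0
      rw [hfr, one_div, inv_inv, hfl] at this
      exact_mod_cast this
    | succ n ih =>
      intro k
      rw [GenContFract.of_s_succ, hfr, one_div, inv_inv, ih (k + 1)]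
      congr 4
      ring
  refine GenContFract.ext ?_ (Stream'.Seq.ext fun n => ?_)
  · rw [GenContFract.of_h_eq_floor, hfl]; simp [regularCF]
  · rw [hs n 0, zero_add]; rfl

/-- The finite continued fraction `[s₀, s₁, …, sₖ, y]`. -/
noncomputable def cfAppend (s : List ℕ) (y : ℝ) : ℝ := s.foldr (fun a x => (a : ℝ) + 1 / x) y

lemma cfAppend_cons (a : ℕ) (s : List ℕ) (y : ℝ) :
    cfAppend (a :: s) y = a + 1 / cfAppend s y := rfl

lemma cfAppend_append (s t : List ℕ) (y : ℝ) :
    cfAppend (s ++ t) y = cfAppend s (cfAppend t y) := by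
  simp [cfAppend]

lemma cfAppend_pos (s : List ℕ) {y : ℝ} (hy : 0 < y) : 0 < cfAppend s y := by
  induction s with
  | nil => exact hy
  | cons a s ih => rw [cfAppend_cons]; positivity

lemma one_lt_cfAppend {s : List ℕ} (hs : s ≠ []) (h : ∀ a ∈ s, 1 ≤ a) {y : ℝ} (hy : 0 < y) :
    1 < cfAppend s y := by
  cases s with
  | nil => exact absurd rfl hs
  | cons a s =>
    rw [cfAppend_cons]
    have h1 : (1 : ℝ) ≤ a := by exact_mod_cast h a (by simp)
    have := cfAppend_pos s hy
    have : 0 < 1 / cfAppend s y := by positivity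
    linarith

/-- The complete quotients are the values of the tails of the period, closed up by the fixed point
`y`; the limit is then that of the continued fraction expansion of `y`. -/
lemma periodicCF_eq {s : List ℕ} (hs : s ≠ []) (h : ∀ a ∈ s, 1 ≤ a) {y : ℝ} (hy : 0 < y)
    (hfix : cfAppend s y = y) : periodicCF s = y := by
  have hlen : 0 < s.length := List.length_pos_of_ne_nil hs
  set w : ℕ → ℝ := fun k => cfAppend (s.drop (k % s.length)) y with hw
  have hlt : ∀ k, k % s.length < s.length := fun k => Nat.mod_lt _ hlen
  have hrec : ∀ k, w k = (s.getD (k % s.length) 0 : ℕ) + 1 / w (k + 1) := fun k => by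
    simp only [hw]
    rw [List.drop_eq_getElem_cons (hlt k), cfAppend_cons, List.getD_eq_getElem _ _ (hlt k)]
    congr 2
    rcases Nat.lt_or_ge (k % s.length + 1) s.length with hl | hl
    · rw [Nat.add_mod, Nat.mod_eq_of_lt (a := 1) (by omega), Nat.mod_eq_of_lt hl]
    -- At the end of the period the empty tail has value `y`, which by `hfix` is the value of the
    -- whole period.
    · have he : k % s.length + 1 = s.length := le_antisymm (hlt k) hl
      have h0 : (k + 1) % s.length = 0 := by
        rw [← Nat.mod_add_mod, he, Nat.mod_self]
      rw [h0, he, List.drop_length, List.drop_zero, hfix]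
      rfl
  have hone : ∀ k, 1 < w k := fun k =>
    one_lt_cfAppend (by simp [hlt k]) (fun a ha => h a (List.mem_of_mem_drop ha)) hy
  have h0 : w 0 = y := by simp [hw, hfix]
  rw [periodicCF, regularCF_eq_of hrec hone, h0]
  exact (GenContFract.of_convergence y).limUnder_eq

/-- The word `s` of partial quotients corresponds to the matrix `γ` with positive entries. -/
structure Represents (s : List ℕ) (γ : SL(2, ℤ)) : Prop where
  ne_nil : s ≠ []
  one_le : ∀ a ∈ s, 1 ≤ a
  pos : ∀ i j, 0 < γ i j
  apply_eq : ∀ y : ℝ, 0 < y →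
    cfAppend s y * ((γ 1 0 : ℝ) * y + γ 1 1) = (γ 0 0 : ℝ) * y + γ 0 1

lemma mul_apply_fin_two (γ δ : SL(2, ℤ)) (i j : Fin 2) :
    (γ * δ) i j = γ i 0 * δ 0 j + γ i 1 * δ 1 j := by
  rw [Matrix.SpecialLinearGroup.coe_mul, Matrix.mul_apply, Fin.sum_univ_two]

lemma Represents.append {s t : List ℕ} {γ δ : SL(2, ℤ)} (hs : Represents s γ)
    (ht : Represents t δ) : Represents (s ++ t) (γ * δ) where
  ne_nil := by simp [hs.ne_nil]
  one_le a ha := (List.mem_append.mp ha).elim (hs.one_le a) (ht.one_le a)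
  pos i j := by
    rw [mul_apply_fin_two]
    have := hs.pos i 0; have := hs.pos i 1; have := ht.pos 0 j; have := ht.pos 1 j
    positivity
  apply_eq y hy := by
    have h1 := hs.apply_eq _ (cfAppend_pos t hy)
    have h2 := ht.apply_eq y hy
    rw [cfAppend_append]
    simp only [mul_apply_fin_two]
    push_cast
    linear_combination ((δ 1 0 : ℝ) * y + δ 1 1) * h1 +
      ((γ 0 0 : ℝ) - γ 1 0 * cfAppend s (cfAppend t y)) * h2

lemma Represents.periodicCF_eq {s : List ℕ} {γ : SL(2, ℤ)} (h : Represents s γ) {α : ℝ}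
    (hα : 0 < α) (hfix : MapsReal γ α α) : periodicCF s = α := by
  refine MarkovCycle.periodicCF_eq h.ne_nil h.one_le hα ?_
  apply mul_right_cancel₀ hfix.1
  rw [h.apply_eq α hα, hfix.2]

lemma exists_represents_one_one : ∃ γ, Represents [1, 1] γ := by
  refine ⟨⟨!![2, 1; 1, 1], by simp [Matrix.det_fin_two_of]⟩, by simp, by simp, ?_, ?_⟩
  · intro i j; fin_cases i <;> fin_cases j <;> simp
  · intro y hy
    simp [cfAppend]
    field_simp
    ring

lemma exists_represents_two_two : ∃ γ, Represents [2, 2] γ := by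
  refine ⟨⟨!![5, 2; 2, 1], by simp [Matrix.det_fin_two_of]⟩, by simp, by simp, ?_, ?_⟩
  · intro i j; fin_cases i <;> fin_cases j <;> simp
  · intro y hy
    simp [cfAppend]
    field_simp
    ring

/-! ### The words of a branch -/

lemma exists_represents_predecessors (p : List Side) :
    (∃ γ, Represents (predecessors p).1 γ) ∧ ∃ γ, Represents (predecessors p).2 γ := by
  induction p using List.reverseRecOn with
  | nil => exact ⟨exists_represents_one_one, exists_represents_two_two⟩
  | append_singleton p d ih =>
    obtain ⟨⟨γ, hγ⟩, δ, hδ⟩ := ih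
    rw [predecessors, List.foldl_append]
    cases d
    · exact ⟨⟨γ, hγ⟩, _, hδ.append hγ⟩
    · exact ⟨⟨_, hδ.append hγ⟩, δ, hδ⟩

/-- The `n`-th power of a word, for concatenation. -/
def wordPow (s : List ℕ) (n : ℕ) : List ℕ := (List.replicate n s).flatten

lemma wordPow_succ (s : List ℕ) (n : ℕ) : wordPow s (n + 1) = s ++ wordPow s n := by
  simp [wordPow, List.replicate_succ]

lemma wordPow_succ' (s : List ℕ) (n : ℕ) : wordPow s (n + 1) = wordPow s n ++ s := by
  simp [wordPow, List.replicate_succ']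

lemma predecessors_replicate_left (p : List Side) (n : ℕ) :
    predecessors (p ++ List.replicate n Side.left) =
      ((predecessors p).1, (predecessors p).2 ++ wordPow (predecessors p).1 n) := by
  induction n with
  | zero => simp [wordPow]
  | succ n ih =>
    rw [List.replicate_succ', ← List.append_assoc, predecessors, List.foldl_append,
      ← predecessors, ih, wordPow_succ']
    simp

lemma predecessors_replicate_right (p : List Side) (n : ℕ) :
    predecessors (p ++ List.replicate n Side.right) =
      (wordPow (predecessors p).2 n ++ (predecessors p).1, (predecessors p).2) := by
  induction n with
  | zero => simp [wordPow]
  | succ n ih =>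
    rw [List.replicate_succ', ← List.append_assoc, predecessors, List.foldl_append,
      ← predecessors, ih, wordPow_succ]
    simp

/-- The words of a branch are `V Uⁿ` or `Uⁿ V`. -/
lemma Branch.period_succ (B : Branch) :
    ∃ U V : List ℕ, (∃ γ, Represents U γ) ∧ (∃ γ, Represents V γ) ∧ B.period 0 = U ∧
      ((∀ n, B.period (n + 1) = V ++ wordPow U (n + 1)) ∨
        ∀ n, B.period (n + 1) = wordPow U (n + 1) ++ V) := by
  obtain ⟨side, tip, _⟩ := B
  obtain ⟨hl, hr⟩ := exists_represents_predecessors tip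
  cases side
  · refine ⟨_, _, hl, hr, rfl, Or.inl fun n => ?_⟩
    -- Each step down contributes one copy of the fixed predecessor, and forming the vertex
    -- contributes one more.
    simp only [period, vertex]
    rw [predecessors_replicate_left, wordPow_succ']
    simp
  · refine ⟨_, _, hr, hl, rfl, Or.inr fun n => ?_⟩
    simp only [period, vertex]
    rw [predecessors_replicate_right, wordPow_succ]
    simp

lemma Represents.wordPow {s : List ℕ} {γ : SL(2, ℤ)} (h : Represents s γ) (n : ℕ) :
    Represents (wordPow s (n + 1)) (γ ^ (n + 1)) := by
  induction n with
  | zero => simpa [MarkovCycle.wordPow] using h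
  | succ n ih =>
    rw [wordPow_succ', pow_succ]
    exact ih.append h

/-! ### Fixed points of positive matrices -/

/-- `α` is a positive and `β` a negative fixed point of `γ`. -/
structure FixedPair (γ : SL(2, ℤ)) (α β : ℝ) : Prop where
  left_pos : 0 < α
  right_neg : β < 0
  left : MapsReal γ α α
  right : MapsReal γ β β

lemma FixedPair.lt {γ : SL(2, ℤ)} {α β : ℝ} (h : FixedPair γ α β) : β < α :=
  h.right_neg.trans h.left_pos

/-- The matrix `γ` has positive entries. -/
def IsPos (γ : SL(2, ℤ)) : Prop := ∀ i j, 0 < γ i j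

lemma IsPos.real {γ : SL(2, ℤ)} (hγ : IsPos γ) (i j : Fin 2) : (0 : ℝ) < γ i j := by
  exact_mod_cast hγ i j

lemma mapsReal_iff {γ : SL(2, ℤ)} {α α' : ℝ} :
    MapsReal γ α α' ↔ ∃ μ : ℝ, μ ≠ 0 ∧ (γ 1 0 : ℝ) * α + γ 1 1 = μ ∧
      (γ 0 0 : ℝ) * α + γ 0 1 = μ * α' :=
  ⟨fun h => ⟨_, h.1, rfl, by rw [← h.2, mul_comm]⟩, fun ⟨μ, h0, h1, h2⟩ =>
    ⟨h1 ▸ h0, by rw [h1, h2, mul_comm]⟩⟩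

/-- The two factors are the eigenvalues of `γ`, whose product is the determinant; Vieta's formulas
make this explicit. -/
lemma FixedPair.mul_eq_one {γ : SL(2, ℤ)} {α β : ℝ} (h : FixedPair γ α β) :
    ((γ 1 0 : ℝ) * α + γ 1 1) * ((γ 1 0 : ℝ) * β + γ 1 1) = 1 := by
  have hs : (γ 1 0 : ℝ) * (α + β) = γ 0 0 - γ 1 1 := by
    apply mul_left_cancel₀ (sub_ne_zero.mpr h.lt.ne')
    linear_combination h.left.2 - h.right.2
  have hp : (γ 1 0 : ℝ) * (α * β) = -γ 0 1 := by
    linear_combination -h.left.2 + α * hs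
  linear_combination det_eq_one_real γ + (γ 1 1 : ℝ) * hs + (γ 1 0 : ℝ) * hp

lemma FixedPair.one_lt {γ : SL(2, ℤ)} {α β : ℝ} (hγ : IsPos γ) (h : FixedPair γ α β) :
    1 < (γ 1 0 : ℝ) * α + γ 1 1 := by
  have h1 := h.mul_eq_one
  have h2 : 0 < (γ 1 0 : ℝ) * (α - β) := mul_pos (hγ.real 1 0) (sub_pos.mpr h.lt)
  have h3 : 0 < (γ 1 0 : ℝ) * α + γ 1 1 :=
    add_pos (mul_pos (hγ.real 1 0) h.left_pos) (hγ.real 1 1)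
  nlinarith

/-- A rational fixed point would make `t² - 4` a square, where `t ≥ 3` is the trace; but then `(t -
1)² < t² - 4 < t²`. -/
lemma FixedPair.irrational {γ : SL(2, ℤ)} {α β : ℝ} (hγ : IsPos γ) (h : FixedPair γ α β) :
    Irrational α := by
  rintro ⟨r, rfl⟩
  have hq := h.left.2
  have hsq : IsSquare ((γ 0 0 + γ 1 1) ^ 2 - 4 : ℤ) := by
    rw [← Rat.isSquare_intCast_iff]
    refine ⟨2 * γ 1 0 * r + (γ 1 1 - γ 0 0), ?_⟩
    have hq' : r * ((γ 1 0 : ℚ) * r + γ 1 1) = (γ 0 0 : ℚ) * r + γ 0 1 := by exact_mod_cast hq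
    have hdet : (γ 0 0 : ℚ) * γ 1 1 - (γ 0 1 : ℚ) * γ 1 0 = 1 := by
      exact_mod_cast congrArg (Int.cast : ℤ → ℚ) (det_eq_one γ)
    push_cast
    linear_combination 4 * hdet - 4 * (γ 1 0 : ℚ) * hq'
  obtain ⟨s, hs⟩ := hsq
  have hdet := det_eq_one γ
  have h00 := hγ 0 0
  have h01 := hγ 0 1
  have h10 := hγ 1 0
  have h11 := hγ 1 1
  have ht : 3 ≤ γ 0 0 + γ 1 1 := by
    have : 0 < γ 0 1 * γ 1 0 := mul_pos h01 h10
    by_contra hlt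
    have e0 : γ 0 0 = 1 := by omega
    have e1 : γ 1 1 = 1 := by omega
    rw [e0, e1] at hdet
    omega
  generalize γ 0 0 + γ 1 1 = t at *
  have h1 : |s| < t := by
    apply abs_lt_of_sq_lt_sq _ (by omega)
    linarith [sq s]
  have h2 : t - 1 < |s| := by
    apply lt_of_pow_lt_pow_left₀ 2 (abs_nonneg s)
    rw [sq_abs]
    linarith [sq s, sq_nonneg t, show (t - 1) ^ 2 = t ^ 2 - 2 * t + 1 by ring]
  omega

lemma IsPos.exists_fixedPair {γ : SL(2, ℤ)} (hγ : IsPos γ) : ∃ α β, FixedPair γ α β := by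
  have ha := hγ.real 0 0
  have hb := hγ.real 0 1
  have hc := hγ.real 1 0
  have hd := hγ.real 1 1
  have hdet := det_eq_one_real γ
  obtain ⟨r, hr⟩ : ∃ r, r = √(((γ 0 0 : ℝ) - γ 1 1) ^ 2 + 4 * γ 0 1 * γ 1 0) := ⟨_, rfl⟩
  have hr2 : r ^ 2 = ((γ 0 0 : ℝ) - γ 1 1) ^ 2 + 4 * γ 0 1 * γ 1 0 := by
    rw [hr, Real.sq_sqrt (by positivity)]
  have hr0 : 0 ≤ r := hr ▸ Real.sqrt_nonneg _
  have hbc := mul_pos hb hc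
  obtain ⟨h1, h2⟩ : -r < (γ 0 0 : ℝ) - γ 1 1 ∧ (γ 0 0 : ℝ) - γ 1 1 < r :=
    abs_lt.mp (abs_lt_of_sq_lt_sq (by linarith) hr0)
  -- Here `r² = (γ₀₀ + γ₁₁)² - 4`; the bound makes the eigenvalue at the negative root nonzero.
  have h3 : r < (γ 0 0 : ℝ) + γ 1 1 :=
    lt_of_pow_lt_pow_left₀ 2 (by positivity) (by linarith)
  refine ⟨((γ 0 0 : ℝ) - γ 1 1 + r) / (2 * γ 1 0), ((γ 0 0 : ℝ) - γ 1 1 - r) / (2 * γ 1 0),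
    div_pos (by linarith) (by positivity), div_neg_of_neg_of_pos (by linarith) (by positivity),
    ?_, ?_⟩
  · refine mapsReal_iff.mpr ⟨((γ 0 0 : ℝ) + γ 1 1 + r) / 2, by positivity, ?_, ?_⟩
    · field_simp; ring
    · field_simp; linear_combination -hr2
  · refine mapsReal_iff.mpr ⟨((γ 0 0 : ℝ) + γ 1 1 - r) / 2, by linarith, ?_, ?_⟩
    · field_simp; ring
    · field_simp; linear_combination -hr2

/-! ### Normalized values as quotients, and conjugation -/

/-- The integral of `g(z) (1 / (z - α) - 1 / (z - β)) dz` from `γ z` to `z`, at `z = i`. -/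
noncomputable def pairInt (g : ℂ → ℂ) (γ : SL(2, ℤ)) (α β : ℝ) : ℂ := lineInt g α β (mob γ I) I

lemma I_im_pos : 0 < I.im := by simp

lemma sub_div_sub_im_pos {α β : ℝ} (h : β < α) {z : ℂ} (hz : 0 < z.im) :
    0 < ((z - α) / (z - β)).im := by
  rw [div_im, ← sub_div]
  refine div_pos ?_ (normSq_pos.mpr (sub_real_ne_zero hz β))
  simp
  nlinarith [mul_pos hz (sub_pos.mpr h)]

/-- The quotient stays in the upper half plane, away from the cut of the logarithm. -/
lemma isPrimitive_log {α β : ℝ} (h : β < α) :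
    IsPrimitive (fun _ => 1) α β fun z => log ((z - α) / (z - β)) := fun z hz => by
  have h1 := sub_real_ne_zero hz α
  have h2 := sub_real_ne_zero hz β
  have hd := ((hasDerivAt_id z).sub_const (α : ℂ)).fun_div ((hasDerivAt_id z).sub_const (β : ℂ)) h2
  refine (hd.clog (Or.inr (sub_div_sub_im_pos h hz).ne')).congr_deriv ?_
  simp only [id]
  field_simp

lemma geodesic_sub_div {α β : ℝ} (h : β < α) (s : ℝ) :
    (geodesic α β s - α) / (geodesic α β s - β) = (Real.exp s : ℝ) * I := by
  have e := one_sub_I_mul_ne_zero (Real.exp s)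
  rw [div_eq_iff (sub_real_ne_zero (geodesic_im_pos h s) β), geodesic]
  generalize (Real.exp s : ℂ) = x at *
  field_simp
  ring

lemma FixedPair.two_log {γ : SL(2, ℤ)} {α β : ℝ} (hγ : IsPos γ) (h : FixedPair γ α β) :
    ((γ 1 0 : ℝ) * β + γ 1 1) * Real.exp (2 * Real.log ((γ 1 0 : ℝ) * α + γ 1 1)) =
      (γ 1 0 : ℝ) * α + γ 1 1 := by
  have h1 := h.mul_eq_one
  have h2 := h.one_lt hγ
  rw [two_mul, Real.exp_add, Real.exp_log (by linarith)]
  linear_combination ((γ 1 0 : ℝ) * α + γ 1 1) * h1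

/-- At parameter `s` of the geodesic the logarithmic primitive is `s + iπ/2`, so the integral is the
translation length. -/
lemma FixedPair.pairInt_one {γ : SL(2, ℤ)} {α β : ℝ} (hγ : IsPos γ) (h : FixedPair γ α β) :
    pairInt (fun _ => 1) γ α β = (2 * Real.log ((γ 1 0 : ℝ) * α + γ 1 1) : ℝ) := by
  have hS := h.two_log hγ
  generalize 2 * Real.log ((γ 1 0 : ℝ) * α + γ 1 1) = S at *
  have hpos := geodesic_im_pos h.lt
  have hm : mob γ (geodesic α β S) = geodesic α β 0 := by
    have := denom_ne_zero γ (hpos S)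
    have h := moebius_geodesic (a := γ 0 0) (b := γ 0 1) (c := γ 1 0) (d := γ 1 1) (s := 0)
      h.left.2 h.right.2 hS (by simpa using this)
    simpa [mob] using h
  rw [pairInt, lineInt_mob_self_eq isInvariantHolomorphic_one h.left h.right I_im_pos (hpos S),
    hm, (isPrimitive_log h.lt).lineInt_eq (hpos _) (hpos _)]
  rw [geodesic_sub_div h.lt, geodesic_sub_div h.lt, log_ofReal_mul (Real.exp_pos _) I_ne_zero,
    log_ofReal_mul (Real.exp_pos _) I_ne_zero, Real.log_exp, Real.log_exp]
  simp

/-- The normalized value at a purely periodic continued fraction. -/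
lemma Represents.valNor_eq {f : ℍ → ℂ} (hf : IsModularFunction f) {s : List ℕ} {γ : SL(2, ℤ)}
    (hs : Represents s γ) {α β : ℝ} (h : FixedPair γ α β) :
    valNor f (periodicCF s) = pairInt (fun z => f (UpperHalfPlane.ofComplex z)) γ α β /
      pairInt (fun _ => 1) γ α β := by
  have hγ : IsPos γ := hs.pos
  have hS : 2 * Real.log ((γ 1 0 : ℝ) * α + γ 1 1) ≠ 0 := by
    have := Real.log_pos (h.one_lt hγ)
    positivity
  rw [hs.periodicCF_eq h.left_pos h.left, MarkovCycle.valNor_eq hf (h.irrational hγ) h.lt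
    (hγ 1 0) h.left h.right hS (h.two_log hγ) I_im_pos, h.pairInt_one hγ, pairInt]

/-- Conjugation invariance. -/
lemma FixedPair.exists_swap {P Q : SL(2, ℤ)} (hP : IsPos P) (hQ : IsPos Q) {α β : ℝ}
    (h : FixedPair (Q * P) α β) : ∃ α' β', FixedPair (P * Q) α' β' ∧
      ∀ g, IsInvariantHolomorphic g → pairInt g (P * Q) α' β' = pairInt g (Q * P) α β := by
  -- `P` maps the fixed points of `Q P` to those of `P Q`, with the same eigenvalues.
  have hfix : ∀ {x v₀ v₁ : ℝ}, MapsReal (Q * P) x x → v₀ = (P 0 0 : ℝ) * x + P 0 1 →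
      v₁ = (P 1 0 : ℝ) * x + P 1 1 → v₁ ≠ 0 →
      MapsReal P x (v₀ / v₁) ∧ MapsReal (P * Q) (v₀ / v₁) (v₀ / v₁) := by
    intro x v₀ v₁ hx h₀ h₁ hv
    refine ⟨⟨h₁ ▸ hv, by rw [← h₁, ← h₀]; field_simp⟩, ?_⟩
    obtain ⟨μ, hμ, e₁, e₀⟩ := mapsReal_iff.mp hx
    refine mapsReal_iff.mpr ⟨μ, hμ, ?_, ?_⟩
    · field_simp
      simp only [mul_apply_fin_two] at e₀ e₁ ⊢
      push_cast at e₀ e₁ ⊢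
      rw [h₀, h₁]
      linear_combination (P 1 0 : ℝ) * e₀ + (P 1 1 : ℝ) * e₁
    · field_simp
      simp only [mul_apply_fin_two] at e₀ e₁ ⊢
      push_cast at e₀ e₁ ⊢
      rw [h₀, h₁]
      linear_combination (P 0 0 : ℝ) * e₀ + (P 0 1 : ℝ) * e₁
  obtain ⟨hα0, hβ0, hα, hβ⟩ := h
  obtain ⟨v₀, hv₀⟩ : ∃ v, v = (P 0 0 : ℝ) * α + P 0 1 := ⟨_, rfl⟩
  obtain ⟨v₁, hv₁⟩ : ∃ v, v = (P 1 0 : ℝ) * α + P 1 1 := ⟨_, rfl⟩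
  obtain ⟨u₀, hu₀⟩ : ∃ v, v = (P 0 0 : ℝ) * β + P 0 1 := ⟨_, rfl⟩
  obtain ⟨u₁, hu₁⟩ : ∃ v, v = (P 1 0 : ℝ) * β + P 1 1 := ⟨_, rfl⟩
  have hv₀0 : 0 < v₀ := by
    have := hP.real 0 0; have := hP.real 0 1
    rw [hv₀]; positivity
  have hv₁0 : 0 < v₁ := by
    have := hP.real 1 0; have := hP.real 1 1
    rw [hv₁]; positivity
  obtain ⟨μ, hμ, e₁, e₀⟩ := mapsReal_iff.mp hβ
  -- Since `Q P` fixes `β`, the point `P β` equals `Q⁻¹ β`, and the inverse of a positive matrix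
  -- maps negative numbers to negative numbers.
  have f₀ : u₀ = μ * ((Q 1 1 : ℝ) * β - Q 0 1) := by
    simp only [mul_apply_fin_two] at e₀ e₁
    push_cast at e₀ e₁
    have hdet := det_eq_one_real Q
    rw [hu₀]
    linear_combination (Q 1 1 : ℝ) * e₀ - (Q 0 1 : ℝ) * e₁ -
      ((P 0 0 : ℝ) * β + P 0 1) * hdet
  have f₁ : u₁ = μ * ((Q 0 0 : ℝ) - Q 1 0 * β) := by
    simp only [mul_apply_fin_two] at e₀ e₁
    push_cast at e₀ e₁
    have hdet := det_eq_one_real Q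
    rw [hu₁]
    linear_combination (Q 0 0 : ℝ) * e₁ - (Q 1 0 : ℝ) * e₀ -
      ((P 1 0 : ℝ) * β + P 1 1) * hdet
  have s₀ : (Q 1 1 : ℝ) * β - Q 0 1 < 0 := by
    nlinarith [hQ.real 1 1, hQ.real 0 1]
  have s₁ : 0 < (Q 0 0 : ℝ) - Q 1 0 * β := by
    nlinarith [hQ.real 0 0, hQ.real 1 0]
  have hu₁0 : u₁ ≠ 0 := by rw [f₁]; exact mul_ne_zero hμ s₁.ne'
  have hneg : u₀ / u₁ < 0 := by
    rw [f₀, f₁, mul_div_mul_left _ _ hμ]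
    exact div_neg_of_neg_of_pos s₀ s₁
  obtain ⟨mα, mα'⟩ := hfix hα hv₀ hv₁ hv₁0.ne'
  obtain ⟨mβ, mβ'⟩ := hfix hβ hu₀ hu₁ hu₁0
  refine ⟨_, _, ⟨div_pos hv₀0 hv₁0, hneg, mα', mβ'⟩, fun g hg => ?_⟩
  -- With base point `P i` the path from `P Q P i` to `P i` is the image under `P` of that from `Q P
  -- i` to `i`.
  rw [pairInt, lineInt_mob_self_eq hg mα' mβ' I_im_pos (mob_im_pos P I_im_pos),
    mob_mul P Q (mob_im_pos P I_im_pos), ← mob_mul Q P I_im_pos,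
    lineInt_mob hg mα mβ (mob_im_pos _ I_im_pos) I_im_pos, pairInt]

/-! ### Analytic dependence on parameters -/

/-- Integrals depending on a parameter through a Möbius kernel are analytic in the parameter. -/
lemma analyticAt_integral_moebius {φ u v : ℝ → ℂ} (hφ : ContinuousOn φ (Set.Icc 0 1))
    (hu : Continuous u) (hv : Continuous v) {t₀ : ℂ}
    (h0 : ∀ s ∈ Set.Icc (0 : ℝ) 1, u s + t₀ * v s ≠ 0) :
    AnalyticAt ℂ (fun t : ℂ => ∫ s in (0 : ℝ)..1, φ s * ((1 + t) / (u s + t * v s))) t₀ := by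
  have hIcc : IsCompact (Set.Icc (0 : ℝ) 1) := isCompact_Icc
  obtain ⟨V, hV⟩ := hIcc.exists_bound_of_continuousOn hv.continuousOn
  obtain ⟨W, hW⟩ := hIcc.exists_bound_of_continuousOn (f := fun s => φ s * (u s - v s))
    (hφ.mul (by fun_prop))
  obtain ⟨s₀, hs₀, hmin⟩ := hIcc.exists_isMinOn ⟨0, by simp⟩
    (f := fun s => ‖u s + t₀ * v s‖) (by fun_prop)
  have hm : 0 < ‖u s₀ + t₀ * v s₀‖ := norm_pos_iff.mpr (h0 s₀ hs₀)
  have hmin' : ∀ s ∈ Set.Icc (0 : ℝ) 1, ‖u s₀ + t₀ * v s₀‖ ≤ ‖u s + t₀ * v s‖ :=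
    isMinOn_iff.mp hmin
  generalize ‖u s₀ + t₀ * v s₀‖ = m at *
  have hV0 : 0 ≤ V := (norm_nonneg _).trans (hV 0 (by simp))
  -- The radius is such that the denominator keeps at least half of its minimal modulus `m` on the
  -- segment.
  have hlow : ∀ t ∈ Metric.ball t₀ (m / (2 * (V + 1))), ∀ s ∈ Set.Icc (0 : ℝ) 1,
      m / 2 ≤ ‖u s + t * v s‖ := by
    intro t ht s hs
    rw [mem_ball_iff_norm, lt_div_iff₀ (by positivity)] at ht
    have h1 : ‖(t - t₀) * v s‖ ≤ m / 2 := by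
      rw [norm_mul]
      nlinarith [norm_nonneg (t - t₀), hV s hs, norm_nonneg (v s)]
    have h2 : u s + t₀ * v s = (u s + t * v s) - (t - t₀) * v s := by ring
    have h3 := norm_sub_le (u s + t * v s) ((t - t₀) * v s)
    rw [← h2] at h3
    linarith [hmin' s hs]
  have hne : ∀ t ∈ Metric.ball t₀ (m / (2 * (V + 1))), ∀ s ∈ Set.Icc (0 : ℝ) 1,
      u s + t * v s ≠ 0 := fun t ht s hs =>
    norm_pos_iff.mp ((half_pos hm).trans_le (hlow t ht s hs))
  have hball : ∀ t ∈ Metric.ball t₀ (m / (2 * (V + 1))),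
      Metric.ball t₀ (m / (2 * (V + 1))) ∈ 𝓝 t := fun t ht => Metric.isOpen_ball.mem_nhds ht
  have hsub : Set.uIoc (0 : ℝ) 1 ⊆ Set.Icc 0 1 := by
    rw [Set.uIoc_of_le zero_le_one]; exact Set.Ioc_subset_Icc_self
  have hcont : ∀ t ∈ Metric.ball t₀ (m / (2 * (V + 1))),
      ContinuousOn (fun s => φ s * ((1 + t) / (u s + t * v s))) (Set.Icc 0 1) := fun t ht =>
    hφ.mul (ContinuousOn.div (by fun_prop) (by fun_prop) (hne t ht))
  have hcont' : ∀ t ∈ Metric.ball t₀ (m / (2 * (V + 1))),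
      ContinuousOn (fun s => φ s * (u s - v s) / (u s + t * v s) ^ 2) (Set.Icc 0 1) :=
    fun t ht => ContinuousOn.div (hφ.mul (by fun_prop)) (by fun_prop)
      fun s hs => pow_ne_zero 2 (hne t ht s hs)
  have hr : 0 < m / (2 * (V + 1)) := by positivity
  refine DifferentiableOn.analyticAt (s := Metric.ball t₀ (m / (2 * (V + 1))))
    (fun t ht => ?_) (Metric.ball_mem_nhds _ hr)
  refine DifferentiableAt.differentiableWithinAt (HasDerivAt.differentiableAt
    (intervalIntegral.hasDerivAt_integral_of_dominated_loc_of_deriv_le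
      (F' := fun t s => φ s * (u s - v s) / (u s + t * v s) ^ 2)
      (bound := fun _ => W / (m / 2) ^ 2) (hball t ht) ?_ ?_ ?_ ?_ ?_ ?_).2)
  · filter_upwards [hball t ht] with x hx
    exact ((hcont x hx).mono hsub).aestronglyMeasurable measurableSet_uIoc
  · apply ContinuousOn.intervalIntegrable
    rw [Set.uIcc_of_le zero_le_one]; exact hcont t ht
  · exact ((hcont' t ht).mono hsub).aestronglyMeasurable measurableSet_uIoc
  · refine Eventually.of_forall fun s hs x hx => ?_
    rw [norm_div, norm_pow]
    have := hlow x hx s (hsub hs)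
    have hW0 := (norm_nonneg _).trans (hW s (hsub hs))
    gcongr
    exact hW s (hsub hs)
  · exact intervalIntegrable_const
  · refine Eventually.of_forall fun s hs x hx => ?_
    have hx0 := hne x hx s (hsub hs)
    have h1 : HasDerivAt (fun t : ℂ => 1 + t) 1 x := (hasDerivAt_id x).const_add 1
    have h2 : HasDerivAt (fun t : ℂ => u s + t * v s) (v s) x := by
      simpa using ((hasDerivAt_id x).mul_const (v s)).const_add (u s)
    refine ((h1.fun_div h2 hx0).const_mul (φ s)).congr_deriv ?_
    field_simp
    ring

/-- `q`-summation of an analytic function: a solution `G` of `G(y) - G(q y) = h(y) - h(0)`. -/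
lemma exists_analytic_q_sum {h : ℂ → ℂ} (hh : ∀ y : ℝ, AnalyticAt ℂ h y) {q : ℝ} (hq0 : 0 < q)
    (hq1 : q < 1) : ∃ G : ℂ → ℂ, (∀ y : ℝ, AnalyticAt ℂ G y) ∧
      ∀ y : ℂ, G y = h y - h 0 + G (q * y) := by
  have han : AnalyticAt ℂ h 0 := by simpa using hh 0
  obtain ⟨r₁, hr₁, hd⟩ : ∃ r > 0, DifferentiableOn ℂ h (Metric.ball 0 r) := by
    obtain ⟨s, hs, hd⟩ := han.eventually_analyticAt.exists_mem
    obtain ⟨r, hr, hrs⟩ := Metric.mem_nhds_iff.mp hs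
    exact ⟨r, hr, fun y hy => (hd y (hrs hy)).differentiableAt.differentiableWithinAt⟩
  obtain ⟨C, hC⟩ := han.differentiableAt.isBigO_sub.bound
  obtain ⟨r₂, hr₂, hC⟩ := Metric.mem_nhds_iff.mp hC
  obtain ⟨r, hr⟩ : ∃ r, r = min r₁ r₂ := ⟨_, rfl⟩
  have hr0 : 0 < r := by rw [hr]; positivity
  have hd' : DifferentiableOn ℂ h (Metric.ball 0 r) :=
    hd.mono (Metric.ball_subset_ball (hr ▸ min_le_left _ _))
  have hC' : ∀ y ∈ Metric.ball (0 : ℂ) r, ‖h y - h 0‖ ≤ C * ‖y‖ := fun y hy => by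
    simpa using hC (Metric.ball_subset_ball (hr ▸ min_le_right _ _) hy)
  have hnq : ∀ (n : ℕ) (y : ℂ), ‖(q : ℂ) ^ n * y‖ = q ^ n * ‖y‖ := fun n y => by
    rw [norm_mul, norm_pow, norm_real, Real.norm_of_nonneg hq0.le]
  have hqy : ∀ (n : ℕ) {y : ℂ}, y ∈ Metric.ball (0 : ℂ) r →
      (q : ℂ) ^ n * y ∈ Metric.ball (0 : ℂ) r := fun n y hy => by
    rw [mem_ball_zero_iff] at hy ⊢
    rw [hnq]
    exact (mul_le_of_le_one_left (norm_nonneg y) (pow_le_one₀ hq0.le hq1.le)).trans_lt hy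
  have hC0 : 0 ≤ C := by
    have hy : ((r / 2 : ℝ) : ℂ) ∈ Metric.ball (0 : ℂ) r := by
      rw [mem_ball_zero_iff, norm_real, Real.norm_of_nonneg (by positivity)]; linarith
    have := (norm_nonneg _).trans (hC' _ hy)
    rw [norm_real, Real.norm_of_nonneg (by positivity)] at this
    exact nonneg_of_mul_nonneg_left this (by positivity)
  have hsmall : ∀ y : ℂ, ∃ m : ℕ, (q : ℂ) ^ m * y ∈ Metric.ball (0 : ℂ) r := fun y => by
    have ht : Tendsto (fun m : ℕ => q ^ m * ‖y‖) atTop (𝓝 0) := by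
      simpa using (tendsto_pow_atTop_nhds_zero_of_lt_one hq0.le hq1).mul_const ‖y‖
    obtain ⟨m, hm⟩ := (ht.eventually_lt_const hr0).exists
    exact ⟨m, by rwa [mem_ball_zero_iff, hnq]⟩
  have hbound : ∀ (n : ℕ) (y : ℂ), y ∈ Metric.ball (0 : ℂ) r →
      ‖h ((q : ℂ) ^ n * y) - h 0‖ ≤ C * r * q ^ n := fun n y hy => by
    refine (hC' _ (hqy n hy)).trans ?_
    rw [hnq, mem_ball_zero_iff] at *
    calc C * (q ^ n * ‖y‖) ≤ C * (q ^ n * r) := by gcongr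
      _ = _ := by ring
  have hsumb : Summable fun n : ℕ => C * r * q ^ n :=
    (summable_geometric_of_lt_one hq0.le hq1).mul_left _
  have hsum : ∀ y : ℂ, Summable fun n : ℕ => h ((q : ℂ) ^ n * y) - h 0 := fun y => by
    obtain ⟨m, hm⟩ := hsmall y
    rw [← summable_nat_add_iff m]
    refine Summable.of_norm_bounded hsumb fun n => ?_
    rw [pow_add, mul_assoc]
    exact hbound n _ hm
  -- The series converges because `h(y) - h(0) = O(y)` and only finitely many `qⁿ y` lie outside the
  -- disc.
  obtain ⟨G, hG⟩ : ∃ G : ℂ → ℂ, G = fun y => ∑' n : ℕ, (h ((q : ℂ) ^ n * y) - h 0) := ⟨_, rfl⟩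
  have hGdiff : DifferentiableOn ℂ G (Metric.ball 0 r) := by
    rw [hG]
    refine differentiableOn_tsum_of_summable_norm hsumb (fun n => ?_) Metric.isOpen_ball hbound
    exact (hd'.comp (by fun_prop) fun y hy => hqy n hy).sub_const _
  have hfun : ∀ y : ℂ, G y = h y - h 0 + G (q * y) := fun y => by
    rw [hG]
    simp only
    rw [(hsum y).tsum_eq_zero_add]
    simp only [pow_zero, one_mul, pow_succ, mul_assoc]
  refine ⟨G, ?_, hfun⟩
  -- The functional equation continues analyticity from the disc to every real `y`, by induction on
  -- the number of contractions that bring `y` into the disc.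
  have main : ∀ (m : ℕ) (y : ℝ), (q : ℂ) ^ m * y ∈ Metric.ball (0 : ℂ) r → AnalyticAt ℂ G y := by
    intro m
    induction m with
    | zero =>
      intro y hy
      rw [pow_zero, one_mul] at hy
      exact hGdiff.analyticAt (Metric.isOpen_ball.mem_nhds hy)
    | succ m ih =>
      intro y hy
      have h1 : AnalyticAt ℂ G ((q * y : ℝ) : ℂ) := ih (q * y) (by
        rw [pow_succ, mul_assoc] at hy; exact_mod_cast hy)
      rw [show G = fun y => h y - h 0 + G (q * y) from funext hfun]
      refine ((hh y).sub analyticAt_const).add (AnalyticAt.fun_comp ?_ ?_)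
      · simpa using h1
      · exact analyticAt_const.mul analyticAt_id
  intro y
  obtain ⟨m, hm⟩ := hsmall y
  exact main m y hm

/-- Analytic branches of the roots of two quadratic equations with coefficients depending on
a small parameter. -/
lemma exists_analytic_roots {A : ℝ} (hA : 0 < A) (B C D : ℝ) :
    ∃ ρ τ : ℝ → ℝ, AnalyticAt ℝ ρ 0 ∧ AnalyticAt ℝ τ 0 ∧ ρ 0 = B / A ∧ τ 0 = -C / A ∧
      (∀ᶠ x in 𝓝 0, B + x * ρ x * D = (A + x * ρ x * C) * ρ x) ∧
      ∀ᶠ x in 𝓝 0, τ x * A + C = x * τ x * (τ x * B + D) := by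
  obtain ⟨d, hd⟩ : ∃ d : ℝ → ℝ, d = fun x => (A - D * x) ^ 2 + 4 * B * C * x := ⟨_, rfl⟩
  -- Both equations are quadratic with a leading coefficient divisible by `x`. With the radical in
  -- the denominator, the root that stays finite is `2B/S`, respectively `-2C/S`, without division
  -- by `x`.
  obtain ⟨S, hS⟩ : ∃ S : ℝ → ℝ, S = fun x => (A - D * x) + √(d x) := ⟨_, rfl⟩
  have hd0 : d 0 = A ^ 2 := by simp [hd]
  have hS0 : S 0 = 2 * A := by simp [hS, hd0, Real.sqrt_sq hA.le]; ring
  have hdan : AnalyticAt ℝ d 0 := by rw [hd]; fun_prop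
  have hSan : AnalyticAt ℝ S 0 := by
    have h1 : AnalyticAt ℝ (fun x => √(d x)) 0 := by
      refine AnalyticAt.fun_comp (g := fun y => √y) ?_ hdan
      rw [hd0]
      exact (Real.contDiffAt_sqrt (n := ⊤) (by positivity)).analyticAt
    rw [hS]
    exact AnalyticAt.add (by fun_prop) h1
  have hS0' : S 0 ≠ 0 := by rw [hS0]; positivity
  have hdpos : ∀ᶠ x in 𝓝 0, 0 < d x :=
    hdan.continuousAt.eventually_const_lt (by rw [hd0]; positivity)
  have hSne : ∀ᶠ x in 𝓝 0, S x ≠ 0 := hSan.continuousAt.eventually_ne hS0'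
  have hSq : ∀ᶠ x in 𝓝 0, S x ≠ 0 ∧ S x ^ 2 = 2 * (A - D * x) * S x + 4 * B * C * x := by
    filter_upwards [hdpos, hSne] with x h1 h2
    refine ⟨h2, ?_⟩
    have h3 : √(d x) ^ 2 = (A - D * x) ^ 2 + 4 * B * C * x := by
      rw [Real.sq_sqrt h1.le, hd]
    have h4 : S x = (A - D * x) + √(d x) := by rw [hS]
    rw [h4]
    linear_combination h3
  refine ⟨fun x => 2 * B / S x, fun x => -2 * C / S x, analyticAt_const.div hSan hS0',
    analyticAt_const.div hSan hS0', ?_, ?_, ?_, ?_⟩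
  · simp only [hS0]; field_simp
  · simp only [hS0]; field_simp
  · filter_upwards [hSq] with x ⟨h1, h2⟩
    field_simp
    linear_combination B * h2
  · filter_upwards [hSq] with x ⟨h1, h2⟩
    field_simp
    linear_combination C * h2

/-! ### Eigenbasis coordinates and the expansion of the integrals -/

/-- The point on the real line with projective coordinate `t` with respect to `a` and `b`. -/
noncomputable def linePt (a b t : ℝ) : ℝ := (a + t * b) / (1 + t)

@[simp] lemma linePt_zero (a b : ℝ) : linePt a b 0 = a := by simp [linePt]

/-- `(x, 1)` is an eigenvector of `γ` with eigenvalue `μ`. -/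
def IsEigen (γ : SL(2, ℤ)) (x μ : ℝ) : Prop :=
  (γ 1 0 : ℝ) * x + γ 1 1 = μ ∧ (γ 0 0 : ℝ) * x + γ 0 1 = μ * x

lemma IsEigen.pow {γ : SL(2, ℤ)} {x μ : ℝ} (h : IsEigen γ x μ) (n : ℕ) :
    IsEigen (γ ^ n) x (μ ^ n) := by
  induction n with
  | zero => simp [IsEigen]
  | succ n ih =>
    obtain ⟨h1, h2⟩ := h
    obtain ⟨i1, i2⟩ := ih
    rw [pow_succ γ]
    simp only [IsEigen, mul_apply_fin_two]
    push_cast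
    exact ⟨by linear_combination ((γ ^ n) 1 0 : ℝ) * h2 + ((γ ^ n) 1 1 : ℝ) * h1 + μ * i1,
      by linear_combination ((γ ^ n) 0 0 : ℝ) * h2 + ((γ ^ n) 0 1 : ℝ) * h1 + μ * i2⟩

/-- With respect to the eigenvectors `(a, 1)` and `(b, 1)`, `γ` multiplies the coordinate by `ν /
μ`. -/
lemma IsEigen.mapsReal_linePt {γ : SL(2, ℤ)} {a b μ ν t t' : ℝ} (ha : IsEigen γ a μ)
    (hb : IsEigen γ b ν) (hμ : μ ≠ 0) (htt' : μ * t' = ν * t) (ht : 1 + t ≠ 0)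
    (ht' : 1 + t' ≠ 0) : MapsReal γ (linePt a b t) (linePt a b t') := by
  obtain ⟨a1, a2⟩ := ha
  obtain ⟨b1, b2⟩ := hb
  refine mapsReal_iff.mpr ⟨μ * (1 + t') / (1 + t), by positivity, ?_, ?_⟩
  · rw [linePt]; field_simp
    linear_combination a1 + t * b1 - htt'
  · rw [linePt, linePt]; field_simp
    linear_combination a2 + t * b2 - b * htt'

lemma mapsReal_self {γ : SL(2, ℤ)} {x μ : ℝ} (h : IsEigen γ x μ) : MapsReal γ x x := by
  refine mapsReal_iff.mpr ⟨μ, fun h0 => ?_, h.1, h.2⟩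
  have h1 := h.1
  have h2 := h.2
  have := det_eq_one_real γ
  rw [h0] at h1 h2
  have : (1 : ℝ) = 0 := by linear_combination (γ 0 0 : ℝ) * h1 - (γ 1 0 : ℝ) * h2 - this
  exact one_ne_zero this

/-- The integral of `g(z) / (z - c) dz` over the segment from `p` to `r`, where `c` is the point
with projective coordinate `t` with respect to `a` and `b`. -/
noncomputable def kerInt (g : ℂ → ℂ) (a b : ℝ) (p r : ℂ) (t : ℂ) : ℂ :=
  ∫ s in (0 : ℝ)..1, g (p + s * (r - p)) * (r - p) *
    ((1 + t) / ((p + s * (r - p) - a) + t * (p + s * (r - p) - b)))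

lemma segment_im_pos {p r : ℂ} (hp : 0 < p.im) (hr : 0 < r.im) {s : ℝ}
    (hs : s ∈ Set.Icc (0 : ℝ) 1) : 0 < (p + s * (r - p)).im := by
  have := convex_im_pos.add_smul_sub_mem (x := p) (y := r) hp hr hs
  simpa using this

/-- For `t ≠ -1` the only zero is a real point; for `t = -1`, the point at infinity, the value is `b
- a`. So `kerInt` is analytic at every real `t`, as `exists_analytic_q_sum` requires. -/
lemma kernel_denom_ne_zero {a b : ℝ} (hab : a ≠ b) {z : ℂ} (hz : 0 < z.im) (t : ℝ) :
    (z - a) + (t : ℂ) * (z - b) ≠ 0 := fun h => by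
  have him := congrArg Complex.im h
  have hre := congrArg Complex.re h
  simp at him hre
  have h1 : (1 + t) * z.im = 0 := by linear_combination him
  have h2 : 1 + t = 0 := (mul_eq_zero.mp h1).resolve_right hz.ne'
  obtain rfl : t = -1 := by linarith
  exact hab (by linarith)

lemma IsInvariantHolomorphic.continuousOn_segment (hg : IsInvariantHolomorphic g) {p r : ℂ}
    (hp : 0 < p.im) (hr : 0 < r.im) :
    ContinuousOn (fun s : ℝ => g (p + s * (r - p)) * (r - p)) (Set.Icc 0 1) :=
  ContinuousOn.mul (hg.diff.continuousOn.comp (by fun_prop) fun _ hs => segment_im_pos hp hr hs)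
    continuousOn_const

lemma IsInvariantHolomorphic.analyticAt_kerInt (hg : IsInvariantHolomorphic g) {a b : ℝ}
    (hab : a ≠ b) {p r : ℂ} (hp : 0 < p.im) (hr : 0 < r.im) (t : ℝ) :
    AnalyticAt ℂ (kerInt g a b p r) t :=
  analyticAt_integral_moebius (hg.continuousOn_segment hp hr) (by fun_prop) (by fun_prop)
    fun _ hs => kernel_denom_ne_zero hab (segment_im_pos hp hr hs) t

/-- Each end point has its own coordinate, centred at the fixed point of `U` near which most of its
translates lie. -/
lemma IsInvariantHolomorphic.lineInt_linePt (hg : IsInvariantHolomorphic g) {a b : ℝ}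
    (hab : a ≠ b) {p r : ℂ} (hp : 0 < p.im) (hr : 0 < r.im) {t t' : ℝ} (ht : 1 + t ≠ 0)
    (ht' : 1 + t' ≠ 0) : lineInt g (linePt a b t) (linePt b a t') p r =
      kerInt g a b p r t - kerInt g b a p r t' := by
  obtain ⟨F, hF⟩ := hg.exists_isPrimitive (linePt a b t) (linePt b a t')
  have hker : ∀ {a b t : ℝ}, 1 + t ≠ 0 → a ≠ b → ∀ {z : ℂ}, 0 < z.im →
      (z - linePt a b t)⁻¹ = (1 + t) / ((z - a) + t * (z - b)) := by
    intro a b t ht hab z hz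
    have h1 := kernel_denom_ne_zero hab hz t
    have h2 : (1 + t : ℂ) ≠ 0 := by exact_mod_cast ht
    rw [linePt, inv_eq_iff_eq_inv, inv_div, eq_div_iff h2]
    push_cast
    field_simp
    ring
  have hint : ∀ {a b : ℝ} (t : ℝ), a ≠ b → IntervalIntegrable (fun s : ℝ =>
      g (p + s * (r - p)) * (r - p) * ((1 + t) / ((p + s * (r - p) - a) +
        t * (p + s * (r - p) - b)))) MeasureTheory.volume 0 1 := by
    intro a b t hab
    apply ContinuousOn.intervalIntegrable
    rw [Set.uIcc_of_le zero_le_one]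
    exact (hg.continuousOn_segment hp hr).mul (ContinuousOn.div (by fun_prop) (by fun_prop)
      fun s hs => kernel_denom_ne_zero hab (segment_im_pos hp hr hs) t)
  have hd : ∀ s ∈ Set.uIcc (0 : ℝ) 1, HasDerivAt (fun s : ℝ => F (p + s * (r - p)))
      (g (p + s * (r - p)) * (r - p) * ((1 + t) / ((p + s * (r - p) - a) +
        t * (p + s * (r - p) - b))) - g (p + s * (r - p)) * (r - p) *
        ((1 + t') / ((p + s * (r - p) - b) + t' * (p + s * (r - p) - a)))) s := by
    intro s hs
    rw [Set.uIcc_of_le zero_le_one] at hs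
    have hpos := segment_im_pos hp hr hs
    have h1 : HasDerivAt (fun s : ℝ => p + s * (r - p)) (r - p) s := by
      simpa using ((ofRealCLM.hasDerivAt (x := s)).mul_const (r - p)).const_add p
    refine ((hF _ hpos).comp s h1).congr_deriv ?_
    rw [hker ht hab hpos, hker ht' hab.symm hpos]
    ring
  have := intervalIntegral.integral_eq_sub_of_hasDerivAt hd ((hint t hab).sub (hint t' hab.symm))
  rw [intervalIntegral.integral_sub (hint t hab) (hint t' hab.symm)] at this
  rw [hF.lineInt_eq hp hr, kerInt, kerInt, this]
  simp

lemma sum_range_q {K G : ℂ → ℂ} {q : ℝ} (hG : ∀ y : ℂ, G y = K y - K 0 + G (q * y)) (n : ℕ)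
    (y : ℂ) : ∑ k ∈ Finset.range n, K ((q : ℂ) ^ k * y) = n * K 0 + G y - G ((q : ℂ) ^ n * y) := by
  induction n with
  | zero => simp
  | succ n ih =>
    have := hG ((q : ℂ) ^ n * y)
    rw [← mul_assoc, ← pow_succ'] at this
    rw [Finset.sum_range_succ, ih]
    push_cast
    linear_combination -this

/-- Telescoping of an integral along the orbit of a point. -/
lemma lineInt_pow_eq_sum (g : ℂ → ℂ) (α β : ℝ) (U : SL(2, ℤ)) (n : ℕ) :
    lineInt g α β (mob (U ^ n) I) I =
      ∑ k ∈ Finset.range n, lineInt g α β (mob (U ^ k) (mob U I)) (mob (U ^ k) I) := by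
  induction n with
  | zero => simp [lineInt, mob]
  | succ n ih =>
    rw [Finset.sum_range_succ, ← ih, pow_succ, mob_mul _ _ I_im_pos, add_comm, lineInt_add]

/-- The asymptotic expansion of the cycle integrals of the hyperbolic elements `Uⁿ V`. -/
theorem exists_expansion {U V : SL(2, ℤ)} (hU : IsPos U) (hV : IsPos V) {a b : ℝ}
    (hab : FixedPair U a b) : ∃ q : ℝ, 0 < q ∧ q < 1 ∧ ∃ α β : ℕ → ℝ,
      (∀ᶠ n in atTop, FixedPair (U ^ n * V) (α n) (β n)) ∧
      ∀ g, IsInvariantHolomorphic g → ∃ B : ℝ → ℂ, AnalyticAt ℝ B 0 ∧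
        ∀ᶠ n : ℕ in atTop, pairInt g (U ^ n * V) (α n) (β n) =
          n * pairInt g U a b + B (q ^ n) := by
  obtain ⟨e, he⟩ : ∃ e, e = (U 1 0 : ℝ) * a + U 1 1 := ⟨_, rfl⟩
  have he1 : 1 < e := he ▸ hab.one_lt hU
  have he0 : e ≠ 0 := by positivity
  have hee := hab.mul_eq_one
  rw [← he] at hee
  have hUa : IsEigen U a e := ⟨he.symm, by rw [← hab.left.2, ← he, mul_comm]⟩
  have hUb : IsEigen U b e⁻¹ := by
    have : (U 1 0 : ℝ) * b + U 1 1 = e⁻¹ := eq_inv_of_mul_eq_one_right hee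
    exact ⟨this, by rw [← hab.right.2, this, mul_comm]⟩
  have hne : a - b ≠ 0 := sub_ne_zero.mpr hab.lt.ne'
  obtain ⟨q, hq⟩ : ∃ q, q = e⁻¹ ^ 2 := ⟨_, rfl⟩
  have hq0 : 0 < q := by rw [hq]; positivity
  have hq1 : q < 1 := by
    rw [hq]; exact pow_lt_one₀ (by positivity) (inv_lt_one_of_one_lt₀ he1) two_ne_zero
  -- The matrix of `V` in the eigenbasis of `U`: `V (a, 1) = A (a, 1) + B (b, 1)` and `V (b, 1) = C
  -- (a, 1) + D (b, 1)`.
  obtain ⟨A, hA⟩ : ∃ A, A = ((V 0 0 : ℝ) * a + V 0 1 - b * ((V 1 0 : ℝ) * a + V 1 1)) / (a - b) :=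
    ⟨_, rfl⟩
  obtain ⟨C, hC⟩ : ∃ C, C = ((V 0 0 : ℝ) * b + V 0 1 - b * ((V 1 0 : ℝ) * b + V 1 1)) / (a - b) :=
    ⟨_, rfl⟩
  obtain ⟨B, hB⟩ : ∃ B, B = (V 1 0 : ℝ) * a + V 1 1 - A := ⟨_, rfl⟩
  obtain ⟨D, hD⟩ : ∃ D, D = (V 1 0 : ℝ) * b + V 1 1 - C := ⟨_, rfl⟩
  have ha := hab.left_pos
  have hb := hab.right_neg
  have v00 := hV.real 0 0
  have v01 := hV.real 0 1
  have v10 := hV.real 1 0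
  have v11 := hV.real 1 1
  have hA0 : 0 < A := by
    rw [hA]
    refine div_pos ?_ (sub_pos.mpr hab.lt)
    have h1 : 0 < (V 1 0 : ℝ) * a + V 1 1 := by positivity
    have h2 : 0 < (V 0 0 : ℝ) * a + V 0 1 := by positivity
    nlinarith
  have hAB : 0 < A + B := by rw [hB]; ring_nf; positivity
  have hAC : A - C = (V 0 0 : ℝ) - V 1 0 * b := by rw [hA, hC]; field_simp; ring
  have hAC' : A * b - C * a = (V 1 1 : ℝ) * b - V 0 1 := by rw [hA, hC]; field_simp; ring
  have hAC0 : 0 < A - C := by rw [hAC]; nlinarith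
  have hAC0' : A * b - C * a < 0 := by rw [hAC']; nlinarith
  have hVa : (V 0 0 : ℝ) * a + V 0 1 = A * a + B * b := by
    rw [hB, hA]; field_simp; ring
  have hVb : (V 0 0 : ℝ) * b + V 0 1 = C * a + D * b := by
    rw [hD, hC]; field_simp; ring
  obtain ⟨ρ, τ, hρ, hτ, hρ0, hτ0, hρeq, hτeq⟩ := exists_analytic_roots hA0 B C D
  have hx : Tendsto (fun n : ℕ => q ^ n) atTop (𝓝 0) :=
    tendsto_pow_atTop_nhds_zero_of_lt_one hq0.le hq1
  have hcρ := hρ.continuousAt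
  have hcτ := hτ.continuousAt
  -- the fixed points
  have hfix : ∀ᶠ x in 𝓝 (0 : ℝ), -1 < ρ x ∧ -1 < τ x ∧ -1 < x * ρ x ∧
      0 < linePt a b (x * ρ x) ∧ linePt b a (τ x) < 0 := by
    -- At `x = 0` the coordinates `B/A` and `-C/A` belong to `V a` and `V⁻¹ b`. Staying above `-1`
    -- keeps all rescaled points away from infinity.
    have e1 : (-1 : ℝ) < ρ 0 := by rw [hρ0, lt_div_iff₀ hA0]; linarith
    have e2 : (-1 : ℝ) < τ 0 := by rw [hτ0, lt_div_iff₀ hA0]; linarith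
    have hxρ : ContinuousAt (fun x => x * ρ x) 0 := continuousAt_id.mul hcρ
    have e3 : (-1 : ℝ) < 0 * ρ 0 := by simp
    have e4 : 0 < linePt a b (0 * ρ 0) := by simpa using ha
    have e5 : linePt b a (τ 0) < 0 := by
      rw [hτ0, linePt]
      have h1 : b + -C / A * a = (A * b - C * a) / A := by field_simp; ring
      have h2 : 1 + -C / A = (A - C) / A := by field_simp; ring
      rw [h1, h2, div_div_div_cancel_right₀ hA0.ne']
      exact div_neg_of_neg_of_pos hAC0' hAC0
    have c4 : ContinuousAt (fun x => linePt a b (x * ρ x)) 0 :=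
      ContinuousAt.div (by fun_prop) (by fun_prop) (by simp)
    have c5 : ContinuousAt (fun x => linePt b a (τ x)) 0 :=
      ContinuousAt.div (by fun_prop) (by fun_prop) (by linarith)
    filter_upwards [hcρ.eventually_const_lt e1, hcτ.eventually_const_lt e2,
      hxρ.eventually_const_lt e3, c4.eventually_const_lt e4, c5.eventually_lt_const e5]
      with x h1 h2 h3 h4 h5 using ⟨h1, h2, h3, h4, h5⟩
  have hen : ∀ n : ℕ, e⁻¹ ^ n = q ^ n * e ^ n := fun n => by
    rw [hq, ← mul_pow]; congr 1; field_simp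
  have hpair : ∀ᶠ n in atTop,
      FixedPair (U ^ n * V) (linePt a b (q ^ n * ρ (q ^ n))) (linePt b a (τ (q ^ n))) := by
    filter_upwards [hx.eventually hfix, hx.eventually hρeq, hx.eventually hτeq]
      with n ⟨h1, h2, h3, h4, h5⟩ h6 h7
    have ea := hUa.pow n
    have eb := hUb.pow n
    rw [hen] at eb
    obtain ⟨ea1, ea2⟩ := ea
    obtain ⟨eb1, eb2⟩ := eb
    -- In the eigenbasis `Uⁿ` is `eⁿ diag(1, x)`; `h6` and `h7` express that the two points give
    -- eigenvectors of `Uⁿ V`, with these eigenvalues.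
    refine ⟨h4, h5, mapsReal_self (μ := e ^ n * (A + q ^ n * ρ (q ^ n) * C)) ⟨?_, ?_⟩,
      mapsReal_self (μ := q ^ n * e ^ n * (τ (q ^ n) * B + D)) ⟨?_, ?_⟩⟩
    all_goals
      generalize q ^ n = x at *
      generalize e ^ n = E at *
      simp only [mul_apply_fin_two]
      push_cast
      rw [linePt]
    · have hy : 1 + x * ρ x ≠ 0 := by linarith
      field_simp
      linear_combination ((U ^ n) 1 0 : ℝ) * (hVa + x * ρ x * hVb) -
        ((U ^ n) 1 1 : ℝ) * (hB + x * ρ x * hD) + (A + x * ρ x * C) * ea1 +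
        (B + x * ρ x * D) * eb1 + x * E * h6
    · have hy : 1 + x * ρ x ≠ 0 := by linarith
      field_simp
      linear_combination ((U ^ n) 0 0 : ℝ) * (hVa + x * ρ x * hVb) -
        ((U ^ n) 0 1 : ℝ) * (hB + x * ρ x * hD) + (A + x * ρ x * C) * ea2 +
        (B + x * ρ x * D) * eb2 + x * E * b * h6
    · have hy : 1 + τ x ≠ 0 := by linarith
      field_simp
      linear_combination ((U ^ n) 1 0 : ℝ) * (hVb + τ x * hVa) -
        ((U ^ n) 1 1 : ℝ) * (hD + τ x * hB) + (C + τ x * A) * ea1 +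
        (D + τ x * B) * eb1 + E * h7
    · have hy : 1 + τ x ≠ 0 := by linarith
      field_simp
      linear_combination ((U ^ n) 0 0 : ℝ) * (hVb + τ x * hVa) -
        ((U ^ n) 0 1 : ℝ) * (hD + τ x * hB) + (C + τ x * A) * ea2 +
        (D + τ x * B) * eb2 + E * a * h7
  refine ⟨q, hq0, hq1, _, _, hpair, fun g hg => ?_⟩
  have hUI := mob_im_pos U I_im_pos
  have hVI := mob_im_pos V I_im_pos
  obtain ⟨G₁, hG₁, hG₁'⟩ := exists_analytic_q_sum
    (hg.analyticAt_kerInt hab.lt.ne' hUI I_im_pos) hq0 hq1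
  obtain ⟨G₂, hG₂, hG₂'⟩ := exists_analytic_q_sum
    (hg.analyticAt_kerInt hab.lt.ne hUI I_im_pos) hq0 hq1
  have hK₁ := hg.analyticAt_kerInt hab.lt.ne' hVI I_im_pos
  have hK₂ := hg.analyticAt_kerInt hab.lt.ne hVI I_im_pos
  have hcomp : ∀ {H : ℂ → ℂ} {σ : ℝ → ℝ}, (∀ y : ℝ, AnalyticAt ℂ H y) → AnalyticAt ℝ σ 0 →
      AnalyticAt ℝ (fun x => H (σ x : ℝ)) 0 := fun hH hσ =>
    ((hH _).restrictScalars (𝕜 := ℝ)).comp_of_eq ((ofRealCLM.analyticAt _).comp hσ) rfl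
  have hxρ : AnalyticAt ℝ (fun x => x * ρ x) 0 := analyticAt_id.mul hρ
  have hxτ : AnalyticAt ℝ (fun x => x * τ x) 0 := analyticAt_id.mul hτ
  -- The boundary terms of the two geometric sums, followed by the contribution of the segment from
  -- `V i` to `i`.
  refine ⟨fun x => G₁ (q * ρ x : ℝ) - G₁ (q * (x * ρ x) : ℝ) -
    (G₂ (τ x : ℝ) - G₂ (x * τ x : ℝ)) + (kerInt g a b (mob V I) I (ρ x : ℝ) -
      kerInt g b a (mob V I) I (x * τ x : ℝ)), ?_, ?_⟩
  · exact (((hcomp hG₁ (analyticAt_const.mul hρ)).sub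
      (hcomp hG₁ (analyticAt_const.mul hxρ))).sub ((hcomp hG₂ hτ).sub (hcomp hG₂ hxτ))).add
      ((hcomp hK₁ hρ).sub (hcomp hK₂ hxτ))
  filter_upwards [hx.eventually hfix] with n ⟨h1, h2, h3, _, _⟩
  -- translates of the fixed points
  have hgt : ∀ {y s : ℝ}, -1 < y → 0 < s → s ≤ 1 → 1 + s * y ≠ 0 := fun hy h0 h1 => by
    nlinarith
  have htrans : ∀ k ≤ n,
      MapsReal (U ^ k) (linePt a b (q ^ (n - k) * ρ (q ^ n))) (linePt a b (q ^ n * ρ (q ^ n))) ∧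
      MapsReal (U ^ k) (linePt b a (q ^ k * τ (q ^ n))) (linePt b a (τ (q ^ n))) := by
    intro k hk
    have hqk : q ^ n = q ^ (n - k) * q ^ k := by rw [← pow_add, Nat.sub_add_cancel hk]
    refine ⟨(hUa.pow k).mapsReal_linePt (hUb.pow k) (by positivity) ?_
      (hgt h1 (by positivity) (pow_le_one₀ hq0.le hq1.le))
      (hgt h1 (by positivity) (pow_le_one₀ hq0.le hq1.le)),
      (hUb.pow k).mapsReal_linePt (hUa.pow k) (by positivity) ?_
      (hgt h2 (by positivity) (pow_le_one₀ hq0.le hq1.le)) (by linarith)⟩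
    · rw [hen k]
      linear_combination e ^ k * ρ (q ^ n) * hqk
    · rw [hen k]; ring
  -- Moving back by `Uᵏ` makes the path independent of `k`; only the end points vary, as arguments
  -- of the kernels.
  have hseg : ∀ k ≤ n, ∀ p : ℂ, 0 < p.im →
      lineInt g (linePt a b (q ^ n * ρ (q ^ n))) (linePt b a (τ (q ^ n)))
        (mob (U ^ k) p) (mob (U ^ k) I) =
      kerInt g a b p I (q ^ (n - k) * ρ (q ^ n) : ℝ) - kerInt g b a p I (q ^ k * τ (q ^ n) : ℝ) := by
    intro k hk p hp
    rw [lineInt_mob hg (htrans k hk).1 (htrans k hk).2 hp I_im_pos,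
      hg.lineInt_linePt hab.lt.ne' hp I_im_pos
        (hgt h1 (by positivity) (pow_le_one₀ hq0.le hq1.le))
        (hgt h2 (by positivity) (pow_le_one₀ hq0.le hq1.le))]
  have hmain : pairInt g U a b = kerInt g a b (mob U I) I 0 - kerInt g b a (mob U I) I 0 := by
    have := hg.lineInt_linePt (t := 0) (t' := 0) hab.lt.ne' hUI I_im_pos (by simp) (by simp)
    simpa [pairInt] using this
  -- The exponents `n - k` run from `n` down to `1`, hence the reflection and the starting point `q
  -- ρ`.
  have hs1 : ∑ k ∈ Finset.range n, kerInt g a b (mob U I) I (q ^ (n - k) * ρ (q ^ n) : ℝ) =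
      n * kerInt g a b (mob U I) I 0 + G₁ (q * ρ (q ^ n) : ℝ) -
        G₁ (q * (q ^ n * ρ (q ^ n)) : ℝ) := by
    have h := sum_range_q hG₁' n (q * ρ (q ^ n) : ℝ)
    rw [show ((q * (q ^ n * ρ (q ^ n)) : ℝ) : ℂ) = (q : ℂ) ^ n * (q * ρ (q ^ n) : ℝ) by
      push_cast; ring, ← h, ← Finset.sum_range_reflect]
    refine Finset.sum_congr rfl fun k hk => ?_
    have hk' : n - (n - 1 - k) = k + 1 := by have := Finset.mem_range.mp hk; omega
    rw [hk']
    congr 1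
    push_cast
    ring
  have hs2 : ∑ k ∈ Finset.range n, kerInt g b a (mob U I) I (q ^ k * τ (q ^ n) : ℝ) =
      n * kerInt g b a (mob U I) I 0 + G₂ (τ (q ^ n) : ℝ) - G₂ (q ^ n * τ (q ^ n) : ℝ) := by
    have h := sum_range_q hG₂' n (τ (q ^ n) : ℝ)
    push_cast at h ⊢
    exact h
  rw [pairInt, mob_mul _ _ I_im_pos, ← lineInt_add g _ _ _ (mob (U ^ n) I), hseg n le_rfl _ hVI,
    lineInt_pow_eq_sum, Finset.sum_congr rfl fun k hk => hseg k (Finset.mem_range.mp hk).le _ hUI,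
    Finset.sum_sub_distrib, hs1, hs2, hmain, Nat.sub_self, pow_zero, one_mul]
  ring

/-! ### Eventual monotonicity of the error term -/

/-- The factor `xᵐ` does not increase, so it suffices to treat `g / (n E + d)`. The cross-multiplied
difference of consecutive terms tends to `g(0) E > 0`, since `g(qⁿ)` approaches `g(0)` faster than
`1/n`. -/
lemma eventually_strictAnti_of_pos {g d : ℝ → ℝ} (hg : AnalyticAt ℝ g 0) (hd : AnalyticAt ℝ d 0)
    (hg0 : 0 < g 0) {E q : ℝ} (hE : 0 < E) (hq0 : 0 < q) (hq1 : q < 1) (m : ℕ) :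
    ∀ᶠ n : ℕ in atTop,
      0 < (q ^ (n + 1)) ^ m * g (q ^ (n + 1)) / ((n + 1 : ℕ) * E + d (q ^ (n + 1))) ∧
      (q ^ (n + 1)) ^ m * g (q ^ (n + 1)) / ((n + 1 : ℕ) * E + d (q ^ (n + 1))) <
        (q ^ n) ^ m * g (q ^ n) / (n * E + d (q ^ n)) := by
  have hx : Tendsto (fun n : ℕ => q ^ n) atTop (𝓝 0) :=
    tendsto_pow_atTop_nhds_zero_of_lt_one hq0.le hq1
  have hgn : Tendsto (fun n : ℕ => g (q ^ n)) atTop (𝓝 (g 0)) := hg.continuousAt.tendsto.comp hx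
  have hdn : Tendsto (fun n : ℕ => d (q ^ n)) atTop (𝓝 (d 0)) := hd.continuousAt.tendsto.comp hx
  have hgn' := (tendsto_add_atTop_iff_nat 1).mpr hgn
  have hdn' := (tendsto_add_atTop_iff_nat 1).mpr hdn
  have hnat : Tendsto (fun n : ℕ => (n : ℝ)) atTop atTop := tendsto_natCast_atTop_atTop
  have hEn : Tendsto (fun n : ℕ => n * E + d (q ^ n)) atTop atTop :=
    (hnat.atTop_mul_const hE).atTop_add hdn
  have hEpos := hEn.eventually_gt_atTop 0
  have hEpos' := ((tendsto_add_atTop_iff_nat 1).mpr hEn).eventually_gt_atTop 0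
  -- `n (g (qⁿ) - g 0) → 0`
  have hO : (fun n : ℕ => (n : ℝ) * (g (q ^ n) - g 0)) =O[atTop] fun n : ℕ => (n : ℝ) * q ^ n := by
    refine (Asymptotics.isBigO_refl _ _).mul ?_
    have h := hg.differentiableAt.isBigO_sub.comp_tendsto hx
    simp only [sub_zero] at h
    exact h
  have h0 : Tendsto (fun n : ℕ => (n : ℝ) * (g (q ^ n) - g 0)) atTop (𝓝 0) :=
    hO.trans_tendsto (tendsto_self_mul_const_pow_of_lt_one hq0.le hq1)
  have h0' := (tendsto_add_atTop_iff_nat 1).mpr h0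
  have hdiff : Tendsto (fun n : ℕ => g (q ^ n) * ((n + 1 : ℕ) * E + d (q ^ (n + 1))) -
      g (q ^ (n + 1)) * (n * E + d (q ^ n))) atTop (𝓝 (g 0 * E)) := by
    have h1 := ((h0.sub h0').mul_const E).add (((hgn.mul hdn').sub (hgn'.mul hdn)).add
      ((hgn.add (hgn'.sub_const (g 0))).mul_const E))
    refine (h1.congr fun n => ?_).trans (le_of_eq (congrArg 𝓝 ?_))
    · push_cast; ring
    · ring
  filter_upwards [hEpos, hEpos', hdiff.eventually_const_lt (mul_pos hg0 hE),
    hgn.eventually_const_lt hg0, hgn'.eventually_const_lt hg0] with n h1 h2 h3 h4 h5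
  refine ⟨by positivity, ?_⟩
  rw [div_lt_div_iff₀ h2 h1]
  have hle : (q ^ (n + 1)) ^ m ≤ (q ^ n) ^ m := by
    exact pow_le_pow_left₀ (by positivity) (pow_le_pow_of_le_one hq0.le hq1.le n.le_succ) m
  calc (q ^ (n + 1)) ^ m * g (q ^ (n + 1)) * (n * E + d (q ^ n))
      ≤ (q ^ n) ^ m * (g (q ^ (n + 1)) * (n * E + d (q ^ n))) := by
        rw [mul_assoc]; gcongr
    _ < (q ^ n) ^ m * (g (q ^ n) * ((n + 1 : ℕ) * E + d (q ^ (n + 1)))) := by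
        exact mul_lt_mul_of_pos_left (by linarith) (by positivity)
    _ = _ := by ring

/-- A sequence `c + k(qⁿ) / (n E + d(qⁿ))` with `k`, `d` analytic is eventually strictly monotone
towards `c`, or eventually equal to `c`. -/
lemma eventually_liesBetween {k d : ℝ → ℝ} (hk : AnalyticAt ℝ k 0) (hd : AnalyticAt ℝ d 0)
    {E q : ℝ} (hE : 0 < E) (hq0 : 0 < q) (hq1 : q < 1) (c : ℝ) :
    ∀ᶠ n : ℕ in atTop, LiesBetween
      (c + k (q ^ (n + 1)) / ((n + 1 : ℕ) * E + d (q ^ (n + 1)))) c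
      (c + k (q ^ n) / (n * E + d (q ^ n))) := by
  have hx : Tendsto (fun n : ℕ => q ^ n) atTop (𝓝 0) :=
    tendsto_pow_atTop_nhds_zero_of_lt_one hq0.le hq1
  have hx' := (tendsto_add_atTop_iff_nat 1).mpr hx
  by_cases h : ∀ᶠ x in 𝓝 0, k x = 0
  · filter_upwards [hx.eventually h, hx'.eventually h] with n h1 h2
    exact Or.inr (by simp [h1, h2])
  -- Not vanishing identically near `0`, `k` is `xᵐ g(x)` with `g(0) ≠ 0`; the sign of `g(0)`
  -- decides the side of `c`.
  obtain ⟨m, g, hg, hg0, hkg⟩ := hk.exists_eventuallyEq_pow_smul_nonzero_iff.mpr h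
  rcases hg0.lt_or_gt with hneg | hpos
  · filter_upwards [hx.eventually hkg, hx'.eventually hkg,
      eventually_strictAnti_of_pos hg.neg hd (by simpa using hneg) hE hq0 hq1 m] with n h1 h2 h3
    simp only [Pi.neg_apply, mul_neg, neg_div] at h3
    left
    rw [h1, h2]
    simp only [sub_zero, smul_eq_mul]
    rw [Set.uIoo_of_ge (by linarith [h3.1, h3.2])]
    constructor <;> linarith [h3.1, h3.2]
  · filter_upwards [hx.eventually hkg, hx'.eventually hkg,
      eventually_strictAnti_of_pos hg hd hpos hE hq0 hq1 m] with n h1 h2 h3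
    left
    rw [h1, h2]
    simp only [sub_zero, smul_eq_mul]
    rw [Set.uIoo_of_le (by linarith [h3.1, h3.2])]
    constructor <;> linarith [h3.1, h3.2]

/-! ### The error term along a branch -/

/-- Normalized values along a branch, in terms of the hyperbolic elements `Uⁿ V`. -/
lemma Branch.exists_valNor_eq (B : Branch) : ∃ γ δ : SL(2, ℤ), IsPos γ ∧ IsPos δ ∧
    ∀ f, IsModularFunction f →
      (∀ α β, FixedPair γ α β → valNor f (B.quad 0) =
        pairInt (fun z => f (UpperHalfPlane.ofComplex z)) γ α β /
          pairInt (fun _ => 1) γ α β) ∧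
      ∀ n : ℕ, 1 ≤ n → ∀ α β, FixedPair (γ ^ n * δ) α β → valNor f (B.quad n) =
        pairInt (fun z => f (UpperHalfPlane.ofComplex z)) (γ ^ n * δ) α β /
          pairInt (fun _ => 1) (γ ^ n * δ) α β := by
  obtain ⟨U, V, ⟨γ, hγ⟩, ⟨δ, hδ⟩, h0, h⟩ := B.period_succ
  refine ⟨γ, δ, hγ.pos, hδ.pos, fun f hf => ⟨fun α β hαβ => ?_, fun n hn α β hαβ => ?_⟩⟩
  · rw [quad, h0, hγ.valNor_eq hf hαβ]
  · obtain ⟨n, rfl⟩ := Nat.exists_eq_add_of_le' hn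
    rcases h with h | h
    -- The word `V Uⁿ` has matrix `δ γⁿ`, the swap of `γⁿ δ`.
    · obtain ⟨α', β', h', he⟩ := hαβ.exists_swap hδ.pos (hγ.wordPow n).pos
      rw [quad, h n, (hδ.append (hγ.wordPow n)).valNor_eq hf h',
        he _ hf.isInvariantHolomorphic, he _ isInvariantHolomorphic_one]
    · rw [quad, h n, ((hγ.wordPow n).append hδ).valNor_eq hf hαβ]

lemma IsPos.mul {γ δ : SL(2, ℤ)} (hγ : IsPos γ) (hδ : IsPos δ) : IsPos (γ * δ) := fun i j => by
  rw [mul_apply_fin_two]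
  have := hγ i 0; have := hγ i 1; have := hδ 0 j; have := hδ 1 j
  positivity

lemma IsPos.pow_mul {γ δ : SL(2, ℤ)} (hγ : IsPos γ) (hδ : IsPos δ) (n : ℕ) :
    IsPos (γ ^ n * δ) := by
  induction n with
  | zero => simpa using hδ
  | succ n ih => rw [pow_succ', mul_assoc]; exact hγ.mul ih

lemma FixedPair.exists_pairInt_one {γ : SL(2, ℤ)} {α β : ℝ} (hγ : IsPos γ)
    (h : FixedPair γ α β) : ∃ r : ℝ, 0 < r ∧ pairInt (fun _ => 1) γ α β = r :=
  ⟨_, by have := Real.log_pos (h.one_lt hγ); positivity, h.pairInt_one hγ⟩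

/-- The normalized values along a branch converge to the value at the preceding vertex, with an
analytic error term. -/
lemma Branch.exists_valNor_expansion (B : Branch) {f : ℍ → ℂ} (hf : IsModularFunction f) :
    ∃ (E q : ℝ) (K : ℝ → ℂ) (d : ℝ → ℝ), 0 < E ∧ 0 < q ∧ q < 1 ∧ AnalyticAt ℝ K 0 ∧
      AnalyticAt ℝ d 0 ∧ ∀ᶠ n : ℕ in atTop,
        valNor f (B.quad n) =
          valNor f (B.quad 0) + K (q ^ n) / ((n * E + d (q ^ n) : ℝ) : ℂ) := by
  obtain ⟨γ, δ, hγ, hδ, hval⟩ := B.exists_valNor_eq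
  obtain ⟨h0, hn⟩ := hval f hf
  obtain ⟨a, b, hab⟩ := hγ.exists_fixedPair
  obtain ⟨q, hq0, hq1, α, β, hpair, hexp⟩ := exists_expansion hγ hδ hab
  obtain ⟨Bf, hBf, hBf'⟩ := hexp _ hf.isInvariantHolomorphic
  obtain ⟨B₁, hB₁, hB₁'⟩ := hexp _ isInvariantHolomorphic_one
  obtain ⟨E, hE, hE'⟩ := hab.exists_pairInt_one hγ
  have hre : AnalyticAt ℝ (fun x => (B₁ x).re) 0 := (reCLM.analyticAt _).comp hB₁
  have hreC : AnalyticAt ℝ (fun x => ((B₁ x).re : ℂ)) 0 := (ofRealCLM.analyticAt _).comp hre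
  -- With `F` the integral of `f` for `U`, the terms linear in `n` cancel: `(nF + B_f)/(nE + d) -
  -- F/E = (B_f - (F/E) d)/(nE + d)`.
  refine ⟨E, q, fun x => Bf x - valNor f (B.quad 0) * (B₁ x).re, fun x => (B₁ x).re, hE, hq0,
    hq1, hBf.sub (analyticAt_const.mul hreC), hre, ?_⟩
  filter_upwards [hpair, hBf', hB₁', eventually_ge_atTop 1] with n h1 h2 h3 h4
  obtain ⟨r, hr, hr'⟩ := h1.exists_pairInt_one (hγ.pow_mul hδ n)
  have hr'' : r = n * E + (B₁ (q ^ n)).re := by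
    rw [hr', hE'] at h3
    have := congrArg Complex.re h3
    simpa using this
  rw [← hr'', hn n h4 _ _ h1, h2, hr', h0 a b hab, hE']
  have hrC : (r : ℂ) ≠ 0 := by exact_mod_cast hr.ne'
  have hEC : (E : ℂ) ≠ 0 := by exact_mod_cast hE.ne'
  have hr3 : (r : ℂ) = n * E + (B₁ (q ^ n)).re := by exact_mod_cast hr''
  generalize ((B₁ (q ^ n)).re : ℂ) = y at *
  obtain rfl : y = r - n * E := by rw [hr3]; ring
  field_simp
  ring

end MarkovCycle

theorem theorem2 (f : ℍ → ℂ) (hf : MarkovCycle.IsModularFunction f) (B : MarkovCycle.Branch) :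
    ∃ N : ℕ, ∀ n : ℕ, N ≤ n →
      MarkovCycle.LiesBetween (MarkovCycle.valNor f (B.quad (n + 1))).re
        (MarkovCycle.valNor f (B.quad 0)).re (MarkovCycle.valNor f (B.quad n)).re ∧
      MarkovCycle.LiesBetween (MarkovCycle.valNor f (B.quad (n + 1))).im
        (MarkovCycle.valNor f (B.quad 0)).im (MarkovCycle.valNor f (B.quad n)).im := by
  obtain ⟨E, q, K, d, hE, hq0, hq1, hK, hd, h⟩ := B.exists_valNor_expansion hf
  have hre := MarkovCycle.eventually_liesBetween (k := fun x => (K x).re)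
    ((Complex.reCLM.analyticAt _).comp hK) hd hE hq0 hq1 (MarkovCycle.valNor f (B.quad 0)).re
  have him := MarkovCycle.eventually_liesBetween (k := fun x => (K x).im)
    ((Complex.imCLM.analyticAt _).comp hK) hd hE hq0 hq1 (MarkovCycle.valNor f (B.quad 0)).im
  refine Filter.eventually_atTop.mp ?_
  filter_upwards [h, (Filter.tendsto_add_atTop_nat 1).eventually h, hre, him] with n h1 h2 h3 h4
  rw [h1, h2]
  -- The denominator is real, so real and imaginary parts separate.
  simp only [Complex.add_re, Complex.add_im, Complex.div_ofReal_re, Complex.div_ofReal_im]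
  exact ⟨h3, h4⟩
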